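/- **Conventions.** A *restriction category* is a category with an operation $f\mapsto\bar f$ sending $f:A\to B$ to $\bar f:A\to A$ such that $f\bar f=f$, $\bar f\bar g=\bar g\bar f$, $\overline{g\bar f}=\bar g\bar f$ and $\bar g f=f\,\overline{gf}$ whenever these make sense. Maps of the form $\bar f$ are *restriction idempotents*, $\mathcal O(A)$ is the set of those on $A$, and $f$ is *total* if $\bar f=1$. For parallel maps, $f\leqslant g$ means $f=g\bar f$, and $f\smile g$ means $f\bar g=g\bar f$. A restriction category is a *join restriction category* if every pairwise compatible ($\smile$) family of parallel maps has a join for $\leqslant$ and these joins are preserved by precomposition. A *local atlas* on $X$ is a set $I$ with a matrix $\varphi_{ij}\in\mathcal O(X)$ ($i,j\in I$) such that $\varphi_{ij}=\varphi_{ji}$ and $\varphi_{jk}\varphi_{ij}\leqslant\varphi_{ik}$. A *glueing* of it is a total map $p:A\to X$ together with maps $p_i:A\to X$ and $s_i:X\to A$ $(i\in I)$ such that $s_ip_i=\overline{p_i}$, $p_is_i=\overline{s_i}$, $p=\bigvee_ip_i$ and $p_js_i=\varphi_{ij}$; $\mathcal C$ *has local glueings* if every local atlas on every object has a glueing. A *partial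 section* of $p:A\to X$ is a map $s:X\to A$ with $ps=\bar s$; for $f:Y\to X$ for which the pullback $A\times_XY$ exists, its pullback along $f$ is the partial section $f^*s=(sf,\overline{sf}):Y\to A\times_XY$ of the projection to $Y$. Let $\mathcal C$ be a join restriction category with local glueings (index sets of atlases being as small as the hom-sets of $\mathcal C$). **The category $\mathrm{rCat}/\!/\mathcal C$.** Its objects are restriction categories $\mathcal A$ (with hom-sets of the same size as those of $\mathcal C$) with a functor $P:\mathcal A\to\mathcal C$ that preserves $\bar{(\ )}$; a map $(\mathcal A,P)\to(\mathcal B,Q)$ is a restriction-preserving functor $F:\mathcal A\to\mathcal B$ with a natural transformation $\alpha:QF\Rightarrow P$ with total components. Composition is by pasting: the composite of $(F,\alpha)$ followed by $(G,\beta)$ is $(GF,\alpha\circ\beta F)$. **The category $\mathrm{pCat}_c(\mathcal C)$.** An object $\mathbb A$ is a set $I$ with objects $A_i$ and $A_{ij}$ of $\mathcal C$, total maps $\sigma_{ij}:A_{ij}\to A_i$ (admitting pullbacks in $\mathcal C$ along all total maps) and $\tau_{ij}:A_{ij}\to A_j$, identities $\eta_i:A_i\to A_{ii}$ with $\sigma_{ii}\eta_i=1=\tau_{ii}\eta_i$,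 and compositions $\mu_{ijk}:A_{jk}\times_{A_j}A_{ij}\to A_{ik}$ with $\sigma_{ik}\mu_{ijk}=\sigma_{ij}\pi_2$ and $\tau_{ik}\mu_{ijk}=\tau_{jk}\pi_1$, satisfying the unit and associativity laws. A morphism (*partite cofunctor*) $F:\mathbb A\to\mathbb B$ from an $I$-partite to a $J$-partite category is a function $F:I\to J$ with total maps $F_i:B_{Fi}\to A_i$ and $F_{ij}:A_{ij}\times_{A_i}B_{Fi}\to B_{Fi,Fj}$ such that $\sigma_{Fi,Fj}F_{ij}=\pi_2$, $F_j\tau_{Fi,Fj}F_{ij}=\tau_{ij}\pi_1$, $F_{ii}(\eta_iF_i,1)=\eta_{Fi}$, and, on $A_{jk}\times_{A_j}A_{ij}\times_{A_i}B_{Fi}$ with generalised elements $(a',a,b)$, $F_{ik}(\mu(a',a),b)=\mu\bigl(F_{jk}(a',\tau_{Fi,Fj}F_{ij}(a,b)),F_{ij}(a,b)\bigr)$. The composite of $F$ and $G$ has $(GF)(i)=G(F(i))$, $(GF)_i=F_iG_{Fi}$ and $(GF)_{ij}(a,c)=G_{Fi,Fj}(F_{ij}(a,G_{Fi}c),c)$.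 **The functor $\Phi:\mathrm{pCat}_c(\mathcal C)\to\mathrm{rCat}/\!/\mathcal C$.** $\Phi\mathbb A$ has object set $I$; its maps $i\to j$ are the partial sections of $\sigma_{ij}$; the identity of $i$ is $\eta_i$; the composite of $s:i\to j$ and $t:j\to k$ is $\mu_{ijk}\circ\tau_{ij}^*(t)\circ s$; the restriction of $s$ is $\eta_i\bar s$. Its functor $\pi_{\mathbb A}$ to $\mathcal C$ sends $i$ to $A_i$ and $s$ to $\tau_{ij}s$. A cofunctor $F:\mathbb A\to\mathbb B$ is sent to the functor $i\mapsto Fi$, $s\mapsto F_{ij}\circ F_i^*s$, with the transformation whose components are $F_i:B_{Fi}\to A_i$. **Internalisation.** For $P:\mathcal A\to\mathcal C$ and $f,g:i\to j$ in $\mathcal A$ put $$[\![f=g]\!]_P=\bigvee\{Pe: e\in\mathcal O(i),\ e\leqslant\bar f\bar g,\ fe=ge\}\in\mathcal O(Pi).$$ **Theorem.** 1. For every $P:\mathcal A\to\mathcal C$ in $\mathrm{rCat}/\!/\mathcal C$ and all $i,j\in\mathcal A$, the matrix $([\![f=g]\!]_P)_{f,g\in\mathcal A(i,j)}$ has a glueing.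 For every choice of glueings $\sigma_{ij}:\Psi P_{ij}\to Pi$ of these matrices, with associated partial sections $s_f:Pi\to\Psi P_{ij}$ $(f\in\mathcal A(i,j))$, there is exactly one $\mathrm{ob}(\mathcal A)$-partite internal category $\Psi P$ in $\mathcal C$ with objects of objects $Pi$, objects of arrows $\Psi P_{ij}$ and source maps $\sigma_{ij}$ such that $\tau_{ij}s_f=Pf$, $\eta_i=s_{1_i}$ and $\mu_{ijk}\circ\tau_{ij}^*(s_g)\circ s_f=s_{gf}$ for all $f:i\to j$ and $g:j\to k$ in $\mathcal A$. 2. For every such $\Psi P$, the functor $\eta_P:\mathcal A\to\Phi\Psi P$ that is the identity on objects and sends $f$ to $s_f$, with the identity transformation $\pi_{\Psi P}\,\eta_P=P$, is a map $P\to\Phi\Psi P$ of $\mathrm{rCat}/\!/\mathcal C$ and exhibits $\Psi P$ as the value at $P$ of a left adjoint of $\Phi$: for every $\mathbb B$ in $\mathrm{pCat}_c(\mathcal C)$ and every map $G:P\to\Phi\mathbb B$ there is exactly one cofunctor $F:\Psi P\to\mathbb B$ with $\Phi F\circ\eta_P=G$. 3. Consequently, for every choice of $\Psi P$ as in 1 for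 each $P$, the assignment $P\mapsto\Psi P$ is the object part of a functor $\Psi$ with an adjunction $$\Psi\dashv\Phi:\mathrm{pCat}_c(\mathcal C)\to\mathrm{rCat}/\!/\mathcal C$$ whose unit at $P$ is $\eta_P$. -/

import Mathlib

open CategoryTheory CategoryTheory.Limits

universe w v u

/-! ### Restriction categories -/

/-- A restriction category. Composition is written in diagrammatic order. -/
class RestrictionCategory (C : Type u) [Category.{v} C] where
  rest : ∀ {A B : C}, (A ⟶ B) → (A ⟶ A)
  rest_comp : ∀ {A B : C} (f : A ⟶ B), rest f ≫ f = f
  rest_comm : ∀ {A B B' : C} (f : A ⟶ B) (g : A ⟶ B'), rest f ≫ rest g = rest g ≫ rest f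
  rest_rest_comp : ∀ {A B B' : C} (f : A ⟶ B) (g : A ⟶ B'),
    rest (rest f ≫ g) = rest f ≫ rest g
  comp_rest : ∀ {A B B' : C} (f : A ⟶ B) (g : B ⟶ B'), f ≫ rest g = rest (f ≫ g) ≫ f

section

variable {C : Type u} [Category.{v} C]

theorem comp_lift {A X Y Z W : C} {p : A ⟶ X} {f : Y ⟶ X} [HasPullback p f]
    (h : W ⟶ Z) (a : Z ⟶ A) (b : Z ⟶ Y) (w : a ≫ p = b ≫ f) :
    h ≫ pullback.lift a b w = pullback.lift (h ≫ a) (h ≫ b)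
      (by rw [Category.assoc, w, Category.assoc]) := by
  apply pullback.hom_ext
  · simp only [Category.assoc, pullback.lift_fst]
  · simp only [Category.assoc, pullback.lift_snd]

theorem lift_congr {A X Y Z : C} {p : A ⟶ X} {f f' : Y ⟶ X} [HasPullback p f]
    [HasPullback p f'] {a a' : Z ⟶ A} {b b' : Z ⟶ Y} {B : C}
    {m : pullback p f ⟶ B} {m' : pullback p f' ⟶ B} (hf : f = f') (hm : HEq m m')
    (w : a ≫ p = b ≫ f) (w' : a' ≫ p = b' ≫ f') (ha : a = a') (hb : b = b') :
    pullback.lift a b w ≫ m = pullback.lift a' b' w' ≫ m' := by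
  subst hf ha hb
  cases hm
  rfl

theorem heq_of_lift {A X Y : C} {p : A ⟶ X} {f f' : Y ⟶ X} [i1 : HasPullback p f]
    [i2 : HasPullback p f'] {B : C} {m : pullback p f ⟶ B} {m' : pullback p f' ⟶ B} (hf : f = f')
    (h : m = pullback.lift (pullback.fst p f) (pullback.snd p f)
      (hf ▸ pullback.condition) ≫ m') : HEq m m' := by
  subst hf
  refine heq_of_eq (h.trans ?_)
  have : pullback.lift (pullback.fst p f) (pullback.snd p f) pullback.condition = 𝟙 _ := by
    apply pullback.hom_ext
    · rw [pullback.lift_fst, Category.id_comp]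
    · rw [pullback.lift_snd, Category.id_comp]
  rw [this, Category.id_comp]

theorem comp_lift_comp {A X Y Z W B : C} {p : A ⟶ X} {f : Y ⟶ X} [HasPullback p f]
    (h : W ⟶ Z) (a : Z ⟶ A) (b : Z ⟶ Y) (w : a ≫ p = b ≫ f) (m : pullback p f ⟶ B) :
    h ≫ pullback.lift a b w ≫ m = pullback.lift (h ≫ a) (h ≫ b)
      (by rw [Category.assoc, w, Category.assoc]) ≫ m := by
  rw [← Category.assoc, comp_lift]

theorem eq_lift_comp {A X Y B Z : C} {p : A ⟶ X} {f : Y ⟶ X} [HasPullback p f]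
    (z : Z ⟶ pullback p f) (m : pullback p f ⟶ B) :
    z ≫ m = pullback.lift (z ≫ pullback.fst p f) (z ≫ pullback.snd p f)
      (by rw [Category.assoc, pullback.condition, Category.assoc]) ≫ m := by
  congr 1
  apply pullback.hom_ext
  · rw [pullback.lift_fst]
  · rw [pullback.lift_snd]

end

namespace RestrictionCategory

section

variable {C : Type u} [Category.{v} C] [RestrictionCategory C]

/-- A map is total when its restriction is the identity. -/
class IsTotal {A B : C} (f : A ⟶ B) : Prop where
  rest_eq : rest f = 𝟙 A

/-- Restriction idempotents: the endomorphisms of the form `rest f`, equivalently the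
endomorphisms that are their own restriction (`isRestIdem_iff`). -/
def IsRestIdem {A : C} (e : A ⟶ A) : Prop :=
  ∃ (B : C) (f : A ⟶ B), e = rest f

/-- The canonical order on parallel maps. -/
def Le {A B : C} (f g : A ⟶ B) : Prop :=
  f = rest f ≫ g

/-- Compatibility of parallel maps. -/
def Compat {A B : C} (f g : A ⟶ B) : Prop :=
  rest g ≫ f = rest f ≫ g

/-- `h` is the join of the set `S` of parallel maps for the canonical order. -/
def IsJoin {A B : C} (S : Set (A ⟶ B)) (h : A ⟶ B) : Prop :=
  (∀ f ∈ S, Le f h) ∧ ∀ k : A ⟶ B, (∀ f ∈ S, Le f k) → Le h k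

/-- `t` is a partial inverse of `s` (so that `s` is a partial isomorphism). -/
def IsPartialInverse {A B : C} (s : A ⟶ B) (t : B ⟶ A) : Prop :=
  s ≫ t = rest s ∧ t ≫ s = rest t

/-- `s` is a partial section of `p`. -/
def IsPartialSection {A X : C} (p : A ⟶ X) (s : X ⟶ A) : Prop :=
  s ≫ p = rest s

theorem rest_id (A : C) : rest (𝟙 A) = 𝟙 A := by
  simpa using rest_comp (𝟙 A)

theorem le_antisymm' {A B : C} {f g : A ⟶ B} (h : Le f g) (h' : Le g f) : f = g := by
  have e : rest f ≫ rest g ≫ f = rest g ≫ f := by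
    rw [← Category.assoc, rest_comm, Category.assoc, rest_comp]
  exact h.trans ((congrArg (fun x => rest f ≫ x) h').trans (e.trans h'.symm))

theorem rest_idem {A B : C} (f : A ⟶ B) : rest f ≫ rest f = rest f := by
  rw [← rest_rest_comp, rest_comp]

theorem rest_rest {A B : C} (f : A ⟶ B) : rest (rest f) = rest f := by
  have h := rest_rest_comp f (𝟙 A)
  simpa [rest_id] using h

theorem isRestIdem_iff {A : C} (e : A ⟶ A) : IsRestIdem e ↔ rest e = e :=
  ⟨fun ⟨_, f, h⟩ => by rw [h, rest_rest], fun h => ⟨A, e, h.symm⟩⟩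

theorem rest_comp_rest {A B B' : C} (f : A ⟶ B) (g : B ⟶ B') :
    rest (f ≫ rest g) = rest (f ≫ g) := by
  rw [comp_rest, rest_rest_comp]
  conv_lhs => rw [rest_comm, ← rest_rest_comp, ← Category.assoc, rest_comp]

theorem rest_comp_le {A B B' : C} (f : A ⟶ B) (g : B ⟶ B') :
    rest f ≫ rest (f ≫ g) = rest (f ≫ g) := by
  rw [← rest_rest_comp, ← Category.assoc, rest_comp]

theorem rest_comp_total {A B B' : C} (f : A ⟶ B) (g : B ⟶ B') [hg : IsTotal g] :
    rest (f ≫ g) = rest f := by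
  rw [← rest_comp_rest, hg.rest_eq, Category.comp_id]

instance isTotal_id (A : C) : IsTotal (𝟙 A) := ⟨rest_id A⟩

instance isTotal_comp {A B B' : C} (f : A ⟶ B) (g : B ⟶ B') [hf : IsTotal f] [IsTotal g] :
    IsTotal (f ≫ g) := ⟨by rw [rest_comp_total, hf.rest_eq]⟩

theorem isTotal_of_comp {A B B' : C} (f : A ⟶ B) (g : B ⟶ B') (h : IsTotal (f ≫ g)) :
    IsTotal f := by
  refine ⟨?_⟩
  have := rest_comp_le f g
  rwa [h.rest_eq, Category.comp_id] at this

/-- The projections of a pullback of total maps are total. -/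
theorem rest_fst_eq_id {A X Y : C} (p : A ⟶ X) (f : Y ⟶ X) [IsTotal p] [IsTotal f]
    [HasPullback p f] :
    rest (pullback.fst p f) = 𝟙 _ ∧ rest (pullback.snd p f) = 𝟙 _ := by
  have h : rest (pullback.fst p f) = rest (pullback.snd p f) := by
    rw [← rest_comp_total _ p, pullback.condition, rest_comp_total]
  have h1 : rest (pullback.fst p f) = 𝟙 _ := by
    apply pullback.hom_ext
    · rw [rest_comp, Category.id_comp]
    · rw [h, rest_comp, Category.id_comp]
  exact ⟨h1, h ▸ h1⟩

instance isTotal_fst {A X Y : C} (p : A ⟶ X) (f : Y ⟶ X) [IsTotal p] [IsTotal f]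
    [HasPullback p f] : IsTotal (pullback.fst p f) := ⟨(rest_fst_eq_id p f).1⟩

instance isTotal_snd {A X Y : C} (p : A ⟶ X) (f : Y ⟶ X) [IsTotal p] [IsTotal f]
    [HasPullback p f] : IsTotal (pullback.snd p f) := ⟨(rest_fst_eq_id p f).2⟩

/-- A total map that admits a pullback along any total map. -/
class IsCarrable {A X : C} (p : A ⟶ X) : Prop where
  total : IsTotal p
  hasPullback : ∀ {Y : C} (f : Y ⟶ X), IsTotal f → HasPullback p f

instance isTotal_of_isCarrable {A X : C} (p : A ⟶ X) [h : IsCarrable p] : IsTotal p :=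
  h.total

instance hasPullback_of_isCarrable {A X Y : C} (p : A ⟶ X) (f : Y ⟶ X) [h : IsCarrable p]
    [hf : IsTotal f] : HasPullback p f :=
  h.hasPullback f hf

theorem pullSection_cond {A X Y : C} {p : A ⟶ X} (f : Y ⟶ X) {s : X ⟶ A}
    (hs : IsPartialSection p s) : (f ≫ s) ≫ p = rest (f ≫ s) ≫ f := by
  rw [Category.assoc, hs, comp_rest]

/-- The pullback along `f` of a partial section `s` of `p`; it is a partial section
of the projection `pullback.snd p f`. -/
noncomputable def pullSection {A X Y : C} {p : A ⟶ X} (f : Y ⟶ X) [HasPullback p f]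
    {s : X ⟶ A} (hs : IsPartialSection p s) : Y ⟶ pullback p f :=
  pullback.lift (f ≫ s) (rest (f ≫ s)) (pullSection_cond f hs)

theorem comp_pullSection {A X Y Z : C} {p : A ⟶ X} (f : Y ⟶ X) [HasPullback p f]
    {s : X ⟶ A} (hs : IsPartialSection p s) (r : Z ⟶ Y) :
    r ≫ pullSection f hs = pullback.lift (r ≫ f ≫ s) (rest (r ≫ f ≫ s) ≫ r)
      (by simp only [Category.assoc]; rw [hs, ← Category.assoc r f (rest s), comp_rest];
          simp only [Category.assoc]) := by
  apply pullback.hom_ext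
  · simp only [pullSection, Category.assoc, pullback.lift_fst]
  · simp only [pullSection, Category.assoc, pullback.lift_snd, comp_rest]

end

end RestrictionCategory

open RestrictionCategory

/-! ### Join restriction categories and local glueings -/

/-- A restriction category is a join restriction category when every pairwise compatible
family of parallel maps has a join, and these joins are preserved by precomposition. -/
class IsJoinRestriction (C : Type u) [Category.{v} C] [RestrictionCategory C] : Prop where
  exists_join : ∀ {A B : C} (S : Set (A ⟶ B)), (∀ f ∈ S, ∀ g ∈ S, Compat f g) →
    ∃ h, IsJoin S h
  comp_join : ∀ {A' A B : C} (g : A' ⟶ A) (S : Set (A ⟶ B)) (h : A ⟶ B),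
    (∀ f ∈ S, ∀ f' ∈ S, Compat f f') → IsJoin S h →
      IsJoin ((fun f => g ≫ f) '' S) (g ≫ h)

section

variable {C : Type u} [Category.{v} C] [RestrictionCategory C]

/-- An `I`-indexed local atlas on `X`. -/
structure IsLocalAtlas {X : C} {I : Type v} (φ : I → I → (X ⟶ X)) : Prop where
  restIdem : ∀ i j, IsRestIdem (φ i j)
  symm : ∀ i j, φ i j = φ j i
  trans : ∀ i j k, Le (φ i j ≫ φ j k) (φ i k)

/-- A glueing of the matrix `φ`: a local homeomorphism `p : A ⟶ X`, that is, a total map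
with a presentation as a join of partial isomorphisms `part i` (with partial inverses
`sec i`), whose induced matrix `sec i ≫ part j` is `φ i j`. -/
structure Glueing {X : C} {I : Type v} (φ : I → I → (X ⟶ X)) where
  A : C
  p : A ⟶ X
  part : I → (A ⟶ X)
  sec : I → (X ⟶ A)
  total : IsTotal p
  isPartialInverse : ∀ i, IsPartialInverse (part i) (sec i)
  isJoin : IsJoin (Set.range part) p
  induces : ∀ i j, sec i ≫ part j = φ i j

variable (C) in
/-- Every local atlas is induced by some local homeomorphism. -/
class HasLocalGlueings : Prop where
  exists_glueing : ∀ {X : C} {I : Type v} (φ : I → I → (X ⟶ X)), IsLocalAtlas φ →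
    Nonempty (Glueing φ)

theorem Glueing.sec_isPartialSection {X : C} {I : Type v} {φ : I → I → (X ⟶ X)}
    (g : Glueing φ) (i : I) : IsPartialSection g.p (g.sec i) := by
  obtain ⟨h1, h2⟩ := g.isPartialInverse i
  have h3 : g.part i = rest (g.part i) ≫ g.p := g.isJoin.1 _ ⟨i, rfl⟩
  have h4 : g.sec i ≫ rest (g.part i) = g.sec i := by
    rw [← h1, ← Category.assoc, h2, rest_comp]
  unfold IsPartialSection
  rw [← h4, Category.assoc, ← h3, h2, h4]

end

/-! ### Restriction categories over `C` -/

/-- A restriction category with a restriction functor to `C`. -/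
structure RCatOver (C : Type u) [Category.{v} C] [RestrictionCategory C] where
  carrier : Type w
  [cat : Category.{v} carrier]
  [restriction : RestrictionCategory carrier]
  proj : carrier ⥤ C
  proj_rest : ∀ {i j : carrier} (f : i ⟶ j), proj.map (rest f) = rest (proj.map f)

namespace RCatOver

attribute [instance] RCatOver.cat RCatOver.restriction

variable {C : Type u} [Category.{v} C] [RestrictionCategory C]

/-- Lax triangles: a restriction functor `F` together with a total natural transformation
`α : Q F ⟶ P`. -/
structure Hom (P Q : RCatOver.{w} C) where
  functor : P.carrier ⥤ Q.carrier
  map_rest : ∀ {i j : P.carrier} (f : i ⟶ j), functor.map (rest f) = rest (functor.map f)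
  nat : functor ⋙ Q.proj ⟶ P.proj
  nat_total : ∀ i, IsTotal (nat.app i)

/-- The identity triangle. -/
def Hom.id (P : RCatOver.{w} C) : Hom P P where
  functor := 𝟭 _
  map_rest _ := rfl
  nat := { app := fun i => 𝟙 (P.proj.obj i) }
  nat_total _ := isTotal_id _

/-- Pasting of lax triangles. -/
def Hom.comp {P Q R : RCatOver.{w} C} (F : Hom P Q) (G : Hom Q R) : Hom P R where
  functor := F.functor ⋙ G.functor
  map_rest f := by simp [F.map_rest, G.map_rest]
  nat :=
    { app := fun i => G.nat.app (F.functor.obj i) ≫ F.nat.app i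
      naturality := fun i j f => by
        have h1 := G.nat.naturality (F.functor.map f)
        have h2 := F.nat.naturality f
        simp only [Functor.comp_map, Functor.comp_obj] at h1 h2 ⊢
        rw [← Category.assoc, h1, Category.assoc, h2, Category.assoc] }
  nat_total i := by
    have := F.nat_total i
    have := G.nat_total (F.functor.obj i)
    exact isTotal_comp _ _

theorem Hom.ext_of {P Q : RCatOver.{w} C} (F G : Hom P Q)
    (h : F.functor = G.functor)
    (h' : ∀ i, HEq (F.nat.app i) (G.nat.app i)) : F = G := by
  obtain ⟨F, hF, α, hα⟩ := F
  obtain ⟨G, hG, β, hβ⟩ := G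
  obtain rfl : F = G := h
  obtain rfl : α = β := by
    ext i
    exact eq_of_heq (h' i)
  rfl

instance : Category (RCatOver.{w} C) where
  Hom := Hom
  id := Hom.id
  comp := Hom.comp
  id_comp F := Hom.ext_of _ _ rfl fun i => heq_of_eq (Category.comp_id (F.nat.app i))
  comp_id F := Hom.ext_of _ _ rfl fun i => heq_of_eq (Category.id_comp (F.nat.app i))
  assoc F G H := Hom.ext_of _ _ rfl fun i => heq_of_eq (Category.assoc
    (H.nat.app (G.functor.obj (F.functor.obj i))) (G.nat.app (F.functor.obj i)) (F.nat.app i)).symm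

end RCatOver

/-! ### Partite internal categories -/

/-- The structure of a partite internal category on given objects of objects `A₀ i`, objects of
arrows `A₁ i j` and source maps `σ i j`. The arrow `a` of `A₁ i j` followed by the arrow `b` of
`A₁ j k` is represented by the pair `(b, a)` in the pullback of `σ j k` along `τ i j`. -/
structure PartiteStr {C : Type u} [Category.{v} C] [RestrictionCategory C] {I : Type w}
    {A₀ : I → C} {A₁ : I → I → C} (σ : ∀ i j, A₁ i j ⟶ A₀ i) where
  [carrable : ∀ i j, IsCarrable (σ i j)]
  τ : ∀ i j, A₁ i j ⟶ A₀ j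
  [τ_total : ∀ i j, IsTotal (τ i j)]
  η : ∀ i, A₀ i ⟶ A₁ i i
  η_src : ∀ i, η i ≫ σ i i = 𝟙 (A₀ i)
  η_tgt : ∀ i, η i ≫ τ i i = 𝟙 (A₀ i)
  μ : ∀ i j k, pullback (σ j k) (τ i j) ⟶ A₁ i k
  μ_src : ∀ i j k, μ i j k ≫ σ i k = pullback.snd (σ j k) (τ i j) ≫ σ i j
  μ_tgt : ∀ i j k, μ i j k ≫ τ i k = pullback.fst (σ j k) (τ i j) ≫ τ j k
  right_unit : ∀ i j, pullback.lift (f := σ i j) (g := τ i i) (𝟙 (A₁ i j)) (σ i j ≫ η i)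
    (by rw [Category.id_comp, Category.assoc, η_tgt, Category.comp_id]) ≫ μ i i j = 𝟙 (A₁ i j)
  left_unit : ∀ i j, pullback.lift (f := σ j j) (g := τ i j) (τ i j ≫ η j) (𝟙 (A₁ i j))
    (by rw [Category.id_comp, Category.assoc, η_src, Category.comp_id]) ≫ μ i j j = 𝟙 (A₁ i j)
  /-- Associativity; the triple fibre product is the pullback of `σ k l` along
  `pullback.fst (σ j k) (τ i j) ≫ τ j k`. -/
  assoc : ∀ i j k l,
    pullback.lift (f := σ k l) (g := τ i k)
      (pullback.fst (σ k l) (pullback.fst (σ j k) (τ i j) ≫ τ j k))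
      (pullback.snd (σ k l) (pullback.fst (σ j k) (τ i j) ≫ τ j k) ≫ μ i j k)
      (by rw [Category.assoc, μ_tgt, pullback.condition]) ≫ μ i k l =
    pullback.lift (f := σ j l) (g := τ i j)
      (pullback.lift (f := σ k l) (g := τ j k)
        (pullback.fst (σ k l) (pullback.fst (σ j k) (τ i j) ≫ τ j k))
        (pullback.snd (σ k l) (pullback.fst (σ j k) (τ i j) ≫ τ j k) ≫
          pullback.fst (σ j k) (τ i j))
        (by rw [Category.assoc, pullback.condition]) ≫ μ j k l)
      (pullback.snd (σ k l) (pullback.fst (σ j k) (τ i j) ≫ τ j k) ≫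
        pullback.snd (σ j k) (τ i j))
      (by rw [Category.assoc, μ_src, pullback.lift_snd_assoc, Category.assoc, Category.assoc,
        pullback.condition]) ≫ μ i j l

/-- A partite internal category in `C`. -/
structure PCat (C : Type u) [Category.{v} C] [RestrictionCategory C] where
  I : Type w
  obj : I → C
  arr : I → I → C
  src : ∀ i j, arr i j ⟶ obj i
  str : PartiteStr src

namespace PCat

variable {C : Type u} [Category.{v} C] [RestrictionCategory C]

section

variable (A : PCat.{w} C)

abbrev tgt (i j : A.I) : A.arr i j ⟶ A.obj j := A.str.τ i j

abbrev ident (i : A.I) : A.obj i ⟶ A.arr i i := A.str.η i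

instance isCarrable_src (i j : A.I) : IsCarrable (A.src i j) := A.str.carrable i j

instance isTotal_tgt (i j : A.I) : IsTotal (A.tgt i j) := A.str.τ_total i j

abbrev mu (i j k : A.I) : pullback (A.src j k) (A.tgt i j) ⟶ A.arr i k := A.str.μ i j k

/-- Composition of generalized arrows `a`, `b` of `A`. -/
noncomputable def comp {Z : C} {i j k : A.I} (b : Z ⟶ A.arr j k) (a : Z ⟶ A.arr i j)
    (w : b ≫ A.src j k = a ≫ A.tgt i j) : Z ⟶ A.arr i k :=
  pullback.lift b a w ≫ A.mu i j k

theorem comp_congr {Z : C} {i j k : A.I} {b b' : Z ⟶ A.arr j k} {a a' : Z ⟶ A.arr i j}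
    (hb : b = b') (ha : a = a') (w : b ≫ A.src j k = a ≫ A.tgt i j) :
    A.comp b a w = A.comp b' a' (hb ▸ ha ▸ w) := by
  subst hb ha; rfl

theorem comp_src {Z : C} {i j k : A.I} (b : Z ⟶ A.arr j k) (a : Z ⟶ A.arr i j)
    (w : b ≫ A.src j k = a ≫ A.tgt i j) : A.comp b a w ≫ A.src i k = a ≫ A.src i j := by
  rw [comp, Category.assoc, A.str.μ_src, pullback.lift_snd_assoc]

theorem comp_tgt {Z : C} {i j k : A.I} (b : Z ⟶ A.arr j k) (a : Z ⟶ A.arr i j)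
    (w : b ≫ A.src j k = a ≫ A.tgt i j) : A.comp b a w ≫ A.tgt i k = b ≫ A.tgt j k := by
  rw [comp, Category.assoc, A.str.μ_tgt, pullback.lift_fst_assoc]

theorem precomp_comp {Z W : C} {i j k : A.I} (h : W ⟶ Z) (b : Z ⟶ A.arr j k)
    (a : Z ⟶ A.arr i j) (w : b ≫ A.src j k = a ≫ A.tgt i j) :
    h ≫ A.comp b a w = A.comp (h ≫ b) (h ≫ a) (by simp only [Category.assoc, w]) := by
  rw [comp, comp, ← Category.assoc, comp_lift]

theorem comp_ident {Z : C} {i j : A.I} (a : Z ⟶ A.arr i j) :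
    A.comp a (a ≫ A.src i j ≫ A.ident i)
      (by simp only [Category.assoc]; rw [A.str.η_tgt, Category.comp_id]) = a := by
  have h := congrArg (fun x => a ≫ x) (A.str.right_unit i j)
  rw [comp_lift_comp] at h
  exact Eq.trans (lift_congr rfl HEq.rfl _ _ (Category.comp_id _).symm rfl) (h.trans (Category.comp_id _))

theorem ident_comp {Z : C} {i j : A.I} (a : Z ⟶ A.arr i j) :
    A.comp (a ≫ A.tgt i j ≫ A.ident j) a
      (by simp only [Category.assoc]; rw [A.str.η_src, Category.comp_id]) = a := by
  have h := congrArg (fun x => a ≫ x) (A.str.left_unit i j)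
  rw [comp_lift_comp] at h
  exact Eq.trans (lift_congr rfl HEq.rfl _ _ rfl (Category.comp_id _).symm) (h.trans (Category.comp_id _))

theorem comp_assoc {Z : C} {i j k l : A.I} (c : Z ⟶ A.arr k l) (b : Z ⟶ A.arr j k)
    (a : Z ⟶ A.arr i j) (w : b ≫ A.src j k = a ≫ A.tgt i j)
    (w' : c ≫ A.src k l = b ≫ A.tgt j k) :
    A.comp c (A.comp b a w) (by rw [w', comp_tgt]) =
      A.comp (A.comp c b w') a (by rw [comp_src, w]) := by
  have h := congrArg (fun x => pullback.lift (f := A.src k l)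
    (g := pullback.fst (A.src j k) (A.tgt i j) ≫ A.tgt j k) c (pullback.lift b a w)
    (by rw [pullback.lift_fst_assoc, w']) ≫ x) (A.str.assoc i j k l)
  rw [comp_lift_comp, comp_lift_comp] at h
  refine Eq.trans (lift_congr rfl HEq.rfl _ _ ?_ ?_) (Eq.trans h
    (lift_congr rfl HEq.rfl _ _ ?_ ?_))
  · rw [pullback.lift_fst]
  · rw [pullback.lift_snd_assoc, comp]
  · rw [comp_lift_comp, comp]
    exact lift_congr rfl HEq.rfl _ _ (by rw [pullback.lift_fst])
      (by rw [pullback.lift_snd_assoc, pullback.lift_fst])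
  · rw [pullback.lift_snd_assoc, pullback.lift_snd]

end

/-! ### Partite cofunctors -/

/-- A partite cofunctor from `A` to `B`. -/
structure Cofunctor (A B : PCat.{w} C) where
  idx : A.I → B.I
  onObj : ∀ i, B.obj (idx i) ⟶ A.obj i
  [onObj_total : ∀ i, IsTotal (onObj i)]
  onArr : ∀ i j, pullback (A.src i j) (onObj i) ⟶ B.arr (idx i) (idx j)
  [onArr_total : ∀ i j, IsTotal (onArr i j)]
  src : ∀ i j, onArr i j ≫ B.src (idx i) (idx j) = pullback.snd (A.src i j) (onObj i)
  tgt : ∀ i j, onArr i j ≫ B.tgt (idx i) (idx j) ≫ onObj j =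
    pullback.fst (A.src i j) (onObj i) ≫ A.tgt i j
  ident : ∀ i, pullback.lift (f := A.src i i) (g := onObj i) (onObj i ≫ A.ident i)
    (𝟙 (B.obj (idx i))) (by rw [Category.assoc, A.str.η_src, Category.comp_id,
      Category.id_comp]) ≫ onArr i i = B.ident (idx i)
  /-- The composition axiom; the triple fibre product is the pullback of `A.src j k` along
  `pullback.fst (A.src i j) (onObj i) ≫ A.tgt i j`. -/
  mul : ∀ i j k,
    pullback.lift (f := A.src i k) (g := onObj i)
      (pullback.lift (f := A.src j k) (g := A.tgt i j)
        (pullback.fst (A.src j k) (pullback.fst (A.src i j) (onObj i) ≫ A.tgt i j))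
        (pullback.snd (A.src j k) (pullback.fst (A.src i j) (onObj i) ≫ A.tgt i j) ≫
          pullback.fst (A.src i j) (onObj i))
        (by rw [Category.assoc, pullback.condition]) ≫ A.mu i j k)
      (pullback.snd (A.src j k) (pullback.fst (A.src i j) (onObj i) ≫ A.tgt i j) ≫
        pullback.snd (A.src i j) (onObj i))
      (by rw [Category.assoc, A.str.μ_src, pullback.lift_snd_assoc, Category.assoc,
        Category.assoc, pullback.condition]) ≫ onArr i k =
    pullback.lift (f := B.src (idx j) (idx k)) (g := B.tgt (idx i) (idx j))
      (pullback.lift (f := A.src j k) (g := onObj j)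
        (pullback.fst (A.src j k) (pullback.fst (A.src i j) (onObj i) ≫ A.tgt i j))
        (pullback.snd (A.src j k) (pullback.fst (A.src i j) (onObj i) ≫ A.tgt i j) ≫
          onArr i j ≫ B.tgt (idx i) (idx j))
        (by simp only [Category.assoc]; rw [tgt, pullback.condition]) ≫ onArr j k)
      (pullback.snd (A.src j k) (pullback.fst (A.src i j) (onObj i) ≫ A.tgt i j) ≫ onArr i j)
      (by rw [Category.assoc, src, pullback.lift_snd, Category.assoc]) ≫
      B.mu (idx i) (idx j) (idx k)

namespace Cofunctor

instance isTotal_onObj {A B : PCat.{w} C} (F : Cofunctor A B) (i : A.I) : IsTotal (F.onObj i) :=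
  F.onObj_total i

instance isTotal_onArr {A B : PCat.{w} C} (F : Cofunctor A B) (i j : A.I) :
    IsTotal (F.onArr i j) :=
  F.onArr_total i j

/-- The action of a cofunctor on generalized arrows. -/
noncomputable def act {A B : PCat.{w} C} (F : Cofunctor A B) {Z : C} {i j : A.I}
    (a : Z ⟶ A.arr i j) (b : Z ⟶ B.obj (F.idx i)) (w : a ≫ A.src i j = b ≫ F.onObj i) :
    Z ⟶ B.arr (F.idx i) (F.idx j) :=
  pullback.lift a b w ≫ F.onArr i j

section

variable {A B : PCat.{w} C} (F : Cofunctor A B)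

theorem act_congr {Z : C} {i j : A.I} {a a' : Z ⟶ A.arr i j} {b b' : Z ⟶ B.obj (F.idx i)}
    (ha : a = a') (hb : b = b') (w : a ≫ A.src i j = b ≫ F.onObj i) :
    F.act a b w = F.act a' b' (ha ▸ hb ▸ w) := by
  subst ha hb; rfl

theorem act_src {Z : C} {i j : A.I} (a : Z ⟶ A.arr i j) (b : Z ⟶ B.obj (F.idx i))
    (w : a ≫ A.src i j = b ≫ F.onObj i) :
    F.act a b w ≫ B.src (F.idx i) (F.idx j) = b := by
  rw [act, Category.assoc, F.src, pullback.lift_snd]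

theorem act_tgt {Z : C} {i j : A.I} (a : Z ⟶ A.arr i j) (b : Z ⟶ B.obj (F.idx i))
    (w : a ≫ A.src i j = b ≫ F.onObj i) :
    F.act a b w ≫ B.tgt (F.idx i) (F.idx j) ≫ F.onObj j = a ≫ A.tgt i j := by
  rw [act, Category.assoc, F.tgt, pullback.lift_fst_assoc]

theorem precomp_act {Z W : C} (h : W ⟶ Z) {i j : A.I} (a : Z ⟶ A.arr i j)
    (b : Z ⟶ B.obj (F.idx i)) (w : a ≫ A.src i j = b ≫ F.onObj i) :
    h ≫ F.act a b w = F.act (h ≫ a) (h ≫ b) (by simp only [Category.assoc, w]) := by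
  rw [act, act, ← Category.assoc, comp_lift]

theorem act_ident {Z : C} {i : A.I} (b : Z ⟶ B.obj (F.idx i)) :
    F.act (b ≫ F.onObj i ≫ A.ident i) b
      (by simp only [Category.assoc]; rw [A.str.η_src, Category.comp_id]) =
      b ≫ B.ident (F.idx i) := by
  have h := congrArg (fun x => b ≫ x) (F.ident i)
  rw [comp_lift_comp] at h
  exact Eq.trans (lift_congr rfl HEq.rfl _ _ rfl (Category.comp_id _).symm) h

theorem act_comp {Z : C} {i j k : A.I} (a' : Z ⟶ A.arr j k) (a : Z ⟶ A.arr i j)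
    (b : Z ⟶ B.obj (F.idx i)) (w : a ≫ A.src i j = b ≫ F.onObj i)
    (w' : a' ≫ A.src j k = a ≫ A.tgt i j) :
    F.act (A.comp a' a w') b (by rw [comp_src, w]) =
      B.comp (F.act a' (F.act a b w ≫ B.tgt _ _) (by rw [Category.assoc, act_tgt, w']))
        (F.act a b w) (by rw [act_src]) := by
  have h := congrArg (fun x => pullback.lift (f := A.src j k)
    (g := pullback.fst (A.src i j) (F.onObj i) ≫ A.tgt i j) a' (pullback.lift a b w)
    (by rw [pullback.lift_fst_assoc, w']) ≫ x) (F.mul i j k)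
  rw [comp_lift_comp] at h
  replace h := h.trans (comp_lift_comp _ _ _ _ _)
  refine Eq.trans (lift_congr rfl HEq.rfl _ _ ?_ ?_) (Eq.trans h
    (lift_congr rfl HEq.rfl _ _ ?_ ?_))
  · rw [comp_lift_comp, comp]
    exact lift_congr rfl HEq.rfl _ _ (by rw [pullback.lift_fst])
      (by rw [pullback.lift_snd_assoc, pullback.lift_fst])
  · rw [pullback.lift_snd_assoc, pullback.lift_snd]
  · rw [comp_lift_comp, act]
    exact lift_congr rfl HEq.rfl _ _ (by rw [pullback.lift_fst])
      (by rw [pullback.lift_snd_assoc, act, Category.assoc])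
  · rw [pullback.lift_snd_assoc, act]

end

/-- Build a cofunctor from axioms on generalized arrows. -/
noncomputable abbrev ofElements {A B : PCat.{w} C} (idx : A.I → B.I)
    (onObj : ∀ i, B.obj (idx i) ⟶ A.obj i) [∀ i, IsTotal (onObj i)]
    (onArr : ∀ i j, pullback (A.src i j) (onObj i) ⟶ B.arr (idx i) (idx j))
    (src : ∀ i j, onArr i j ≫ B.src (idx i) (idx j) = pullback.snd (A.src i j) (onObj i))
    (tgt : ∀ i j, onArr i j ≫ B.tgt (idx i) (idx j) ≫ onObj j =
      pullback.fst (A.src i j) (onObj i) ≫ A.tgt i j)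
    (ident : ∀ i, pullback.lift (f := A.src i i) (g := onObj i) (onObj i ≫ A.ident i)
      (𝟙 (B.obj (idx i))) (by rw [Category.assoc, A.str.η_src, Category.comp_id,
        Category.id_comp]) ≫ onArr i i = B.ident (idx i))
    (mul : ∀ (Z : C) (i j k : A.I) (a' : Z ⟶ A.arr j k) (a : Z ⟶ A.arr i j)
      (b : Z ⟶ B.obj (idx i)) (w : a ≫ A.src i j = b ≫ onObj i)
      (w' : a' ≫ A.src j k = a ≫ A.tgt i j),
      pullback.lift (A.comp a' a w') b (by rw [comp_src, w]) ≫ onArr i k =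
      B.comp (pullback.lift a' ((pullback.lift a b w ≫ onArr i j) ≫ B.tgt _ _)
          (by simp only [Category.assoc]; rw [tgt, pullback.lift_fst_assoc, w']) ≫ onArr j k)
        (pullback.lift a b w ≫ onArr i j)
        (by simp only [Category.assoc]; rw [src, pullback.lift_snd])) : Cofunctor A B where
  idx := idx
  onObj := onObj
  onArr := onArr
  onArr_total i j := isTotal_of_comp _ (B.src (idx i) (idx j)) (by rw [src]; infer_instance)
  src := src
  tgt := tgt
  ident := ident
  mul i j k := by
    refine Eq.trans (mul _ i j k
      (pullback.fst (A.src j k) (pullback.fst (A.src i j) (onObj i) ≫ A.tgt i j))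
      (pullback.snd (A.src j k) (pullback.fst (A.src i j) (onObj i) ≫ A.tgt i j) ≫
        pullback.fst (A.src i j) (onObj i))
      (pullback.snd (A.src j k) (pullback.fst (A.src i j) (onObj i) ≫ A.tgt i j) ≫
        pullback.snd (A.src i j) (onObj i))
      (by simp only [Category.assoc, pullback.condition])
      (by rw [Category.assoc, pullback.condition])) ?_
    refine lift_congr rfl HEq.rfl _ _ (lift_congr rfl HEq.rfl _ _ rfl ?_) ?_
    · rw [← eq_lift_comp, Category.assoc]
    · rw [← eq_lift_comp]

theorem ext_of {A B : PCat.{w} C} (F G : Cofunctor A B) (h : F.idx = G.idx)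
    (h' : ∀ i, HEq (F.onObj i) (G.onObj i)) (h'' : ∀ i j, HEq (F.onArr i j) (G.onArr i j)) :
    F = G := by
  obtain ⟨f, f0, f1, _, _, _, _⟩ := F
  obtain ⟨g, g0, g1, _, _, _, _⟩ := G
  obtain rfl : f = g := h
  obtain rfl : f0 = g0 := funext fun i => eq_of_heq (h' i)
  obtain rfl : f1 = g1 := funext fun i => funext fun j => eq_of_heq (h'' i j)
  rfl

/-- The identity cofunctor. -/
noncomputable def id (A : PCat.{w} C) : Cofunctor A A :=
  ofElements (fun i => i) (fun i => 𝟙 (A.obj i))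
    (fun i j => pullback.fst (A.src i j) (𝟙 (A.obj i)))
    (fun i j => by rw [pullback.condition, Category.comp_id])
    (fun i j => by rw [Category.comp_id])
    (fun i => by rw [pullback.lift_fst, Category.id_comp])
    (fun Z i j k a' a b w w' => by
      rw [pullback.lift_fst]
      exact A.comp_congr (by rw [pullback.lift_fst]) (by rw [pullback.lift_fst]) _)

/-- The arrow part of a composite cofunctor, the composite
`A₁ ×_{A₀} D₀ ≅ (A₁ ×_{A₀} B₀) ×_{B₀} D₀ ⟶ B₁ ×_{B₀} D₀ ⟶ D₁`. -/
noncomputable def compArr {A B D : PCat.{w} C} (F : Cofunctor A B) (G : Cofunctor B D)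
    (i j : A.I) : pullback (A.src i j) (G.onObj (F.idx i) ≫ F.onObj i) ⟶
      D.arr (G.idx (F.idx i)) (G.idx (F.idx j)) :=
  pullback.lift (f := B.src (F.idx i) (F.idx j)) (g := G.onObj (F.idx i))
    (pullback.lift (f := A.src i j) (g := F.onObj i)
      (pullback.fst (A.src i j) (G.onObj (F.idx i) ≫ F.onObj i))
      (pullback.snd (A.src i j) (G.onObj (F.idx i) ≫ F.onObj i) ≫ G.onObj (F.idx i))
      (by rw [pullback.condition, Category.assoc]) ≫ F.onArr i j)
    (pullback.snd (A.src i j) (G.onObj (F.idx i) ≫ F.onObj i))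
    (by rw [Category.assoc, F.src, pullback.lift_snd]) ≫ G.onArr (F.idx i) (F.idx j)

theorem lift_compArr {A B D : PCat.{w} C} (F : Cofunctor A B) (G : Cofunctor B D)
    {i j : A.I} {Z : C} (a : Z ⟶ A.arr i j) (d : Z ⟶ D.obj (G.idx (F.idx i)))
    (w : a ≫ A.src i j = d ≫ G.onObj (F.idx i) ≫ F.onObj i) :
    pullback.lift a d w ≫ compArr F G i j =
      G.act (F.act a (d ≫ G.onObj (F.idx i)) (by rw [w, Category.assoc])) d
        (by rw [act_src]) := by
  rw [compArr, comp_lift_comp, act]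
  refine lift_congr rfl HEq.rfl _ _ ?_ ?_
  · rw [comp_lift_comp, act]
    refine lift_congr rfl HEq.rfl _ _ ?_ ?_
    · rw [pullback.lift_fst]
    · rw [pullback.lift_snd_assoc]
  · rw [pullback.lift_snd]

theorem compArr_tgt {A B D : PCat.{w} C} (F : Cofunctor A B) (G : Cofunctor B D) (i j : A.I) :
    compArr F G i j ≫ D.tgt (G.idx (F.idx i)) (G.idx (F.idx j)) ≫
      G.onObj (F.idx j) ≫ F.onObj j =
    pullback.fst (A.src i j) (G.onObj (F.idx i) ≫ F.onObj i) ≫ A.tgt i j := by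
  rw [compArr]
  simp only [Category.assoc]
  have h := G.tgt (F.idx i) (F.idx j)
  rw [reassoc_of% h, pullback.lift_fst_assoc, Category.assoc, F.tgt, pullback.lift_fst_assoc]

theorem act_act_comp {A B D : PCat.{w} C} (F : Cofunctor A B) (G : Cofunctor B D)
    {Z : C} {i j k : A.I} (a' : Z ⟶ A.arr j k) (a : Z ⟶ A.arr i j)
    (d : Z ⟶ D.obj (G.idx (F.idx i)))
    (w : a ≫ A.src i j = (d ≫ G.onObj (F.idx i)) ≫ F.onObj i)
    (w' : a' ≫ A.src j k = a ≫ A.tgt i j) :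
    G.act (F.act (A.comp a' a w') (d ≫ G.onObj (F.idx i)) (by rw [comp_src, w])) d
      (by rw [act_src]) =
    D.comp (G.act (F.act a' (G.act (F.act a (d ≫ G.onObj (F.idx i)) w) d (by rw [act_src]) ≫
        D.tgt (G.idx (F.idx i)) (G.idx (F.idx j)) ≫ G.onObj (F.idx j))
          (by rw [act_tgt, Category.assoc, act_tgt, w']))
        (G.act (F.act a (d ≫ G.onObj (F.idx i)) w) d (by rw [act_src]) ≫ D.tgt _ _)
        (by rw [act_src, Category.assoc]))
      (G.act (F.act a (d ≫ G.onObj (F.idx i)) w) d (by rw [act_src]))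
      (by rw [act_src]) := by
  refine Eq.trans (G.act_congr (F.act_comp a' a _ w w') rfl _) ?_
  refine Eq.trans (G.act_comp _ _ d (by rw [act_src]) _) ?_
  refine D.comp_congr ?_ rfl _
  refine G.act_congr ?_ rfl _
  exact F.act_congr rfl (by rw [act_tgt]) _

/-- Composition of cofunctors. -/
noncomputable def comp {A B D : PCat.{w} C} (F : Cofunctor A B) (G : Cofunctor B D) :
    Cofunctor A D :=
  ofElements (fun i => G.idx (F.idx i)) (fun i => G.onObj (F.idx i) ≫ F.onObj i)
    (compArr F G)
    (fun i j => by rw [compArr, Category.assoc, G.src, pullback.lift_snd])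
    (compArr_tgt F G)
    (fun i => by
      rw [lift_compArr]
      refine Eq.trans (G.act_congr ?_ rfl _) (Eq.trans (G.act_ident (𝟙 _)) (Category.id_comp _))
      · refine Eq.trans (F.act_congr ?_ rfl _) (Eq.trans (F.act_ident (𝟙 _ ≫ G.onObj _)) ?_)
        · simp only [Category.assoc, Category.id_comp]
        · rw [Category.assoc])
    (fun Z i j k a' a d w w' => by
      refine Eq.trans (lift_compArr F G _ _ _) ?_
      refine Eq.trans (act_act_comp F G a' a d (by rw [w, Category.assoc]) w') ?_
      refine D.comp_congr (Eq.symm ?_) (lift_compArr F G _ _ _).symm _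
      refine Eq.trans (lift_compArr F G _ _ _) ?_
      refine G.act_congr ?_ ?_ _
      · exact F.act_congr rfl (by rw [lift_compArr, Category.assoc]) _
      · rw [lift_compArr])

theorem id_comp' {A B : PCat.{w} C} (F : Cofunctor A B) : comp (id A) F = F := by
  refine ext_of _ _ rfl (fun i => heq_of_eq (Category.comp_id (F.onObj i)))
    (fun i j => heq_of_lift (i1 := hasPullback_of_isCarrable (A.src i j) (F.onObj i ≫ 𝟙 (A.obj i)))
      (i2 := hasPullback_of_isCarrable (A.src i j) (F.onObj i)) (Category.comp_id (F.onObj i)) ?_)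
  refine lift_congr rfl HEq.rfl _ _ ?_ rfl
  exact pullback.lift_fst (f := A.src i j) (g := 𝟙 (A.obj i)) _ _ _

theorem comp_id' {A B : PCat.{w} C} (F : Cofunctor A B) : comp F (id B) = F := by
  refine ext_of _ _ rfl (fun i => heq_of_eq (Category.id_comp (F.onObj i)))
    (fun i j => heq_of_lift (i1 := hasPullback_of_isCarrable (A.src i j) (𝟙 (B.obj (F.idx i)) ≫ F.onObj i))
      (i2 := hasPullback_of_isCarrable (A.src i j) (F.onObj i)) (Category.id_comp (F.onObj i)) ?_)
  refine Eq.trans (pullback.lift_fst (f := B.src (F.idx i) (F.idx j))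
    (g := 𝟙 (B.obj (F.idx i))) _ _ _) ?_
  exact lift_congr rfl HEq.rfl _ _ rfl (Category.comp_id _)

theorem comp_assoc' {A B D E : PCat.{w} C} (F : Cofunctor A B) (G : Cofunctor B D)
    (H : Cofunctor D E) : comp (comp F G) H = comp F (comp G H) := by
  refine ext_of _ _ rfl
    (fun i => heq_of_eq (Category.assoc (H.onObj _) (G.onObj _) (F.onObj i)).symm)
    (fun i j => heq_of_lift (i1 := hasPullback_of_isCarrable (A.src i j)
        (H.onObj (G.idx (F.idx i)) ≫ G.onObj (F.idx i) ≫ F.onObj i))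
      (i2 := hasPullback_of_isCarrable (A.src i j)
        ((H.onObj (G.idx (F.idx i)) ≫ G.onObj (F.idx i)) ≫ F.onObj i))
      (Category.assoc (H.onObj _) (G.onObj _) (F.onObj i)).symm ?_)
  refine Eq.trans ?_ (lift_compArr F (comp G H) _ _ _).symm
  refine Eq.trans ?_ (lift_compArr G H _ _ _).symm
  refine lift_congr rfl HEq.rfl _ _ ?_ rfl
  refine Eq.trans (lift_compArr F G _ _ _) ?_
  exact G.act_congr (F.act_congr rfl (Category.assoc _ _ _) _) rfl _

noncomputable instance : Category (PCat.{w} C) where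
  Hom := Cofunctor
  id := Cofunctor.id
  comp := Cofunctor.comp
  id_comp := id_comp'
  comp_id := comp_id'
  assoc := comp_assoc'

end Cofunctor

/-! ### Externalisation -/

section

variable (A : PCat.{w} C)

instance isTotal_mu (i j k : A.I) : IsTotal (A.mu i j k) :=
  isTotal_of_comp _ (A.src i k) (by rw [A.str.μ_src]; infer_instance)

instance isTotal_ident (i : A.I) : IsTotal (A.ident i) :=
  isTotal_of_comp _ (A.src i i) (by rw [A.str.η_src]; infer_instance)

/-- Partial sections of the source maps. -/
abbrev PSec (i j : A.I) : Type v :=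
  { s : A.obj i ⟶ A.arr i j // IsPartialSection (A.src i j) s }

theorem rest_lift {X Y Z W : C} {p : X ⟶ W} {f : Y ⟶ W} [IsTotal p] [IsTotal f]
    [HasPullback p f] (a : Z ⟶ X) (b : Z ⟶ Y) (w : a ≫ p = b ≫ f) :
    rest (pullback.lift a b w) = rest a := by
  rw [← rest_comp_total _ (pullback.fst p f), pullback.lift_fst]

theorem rest_comp' {Z : C} {i j k : A.I} (b : Z ⟶ A.arr j k) (a : Z ⟶ A.arr i j)
    (w : b ≫ A.src j k = a ≫ A.tgt i j) : rest (A.comp b a w) = rest b := by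
  rw [comp, rest_comp_total, rest_lift]

variable {A}

/-- The underlying map of the composite of two partial sections: `s`, then the pullback of `t`
along the target map, then the composition map. -/
noncomputable def starMap {i j k : A.I} (s : A.PSec i j) (t : A.PSec j k) :
    A.obj i ⟶ A.arr i k :=
  s.1 ≫ pullSection (A.tgt i j) t.2 ≫ A.mu i j k

theorem star_cond {i j k : A.I} (s : A.PSec i j) (t : A.PSec j k) :
    (s.1 ≫ A.tgt i j ≫ t.1) ≫ A.src j k =
      (rest (s.1 ≫ A.tgt i j ≫ t.1) ≫ s.1) ≫ A.tgt i j := by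
  have h := pullSection_cond (s.1 ≫ A.tgt i j) t.2
  simpa only [Category.assoc] using h

theorem starMap_eq {i j k : A.I} (s : A.PSec i j) (t : A.PSec j k) :
    starMap s t = A.comp (s.1 ≫ A.tgt i j ≫ t.1) (rest (s.1 ≫ A.tgt i j ≫ t.1) ≫ s.1)
      (star_cond s t) := by
  rw [starMap, ← Category.assoc, comp_pullSection, comp]

theorem rest_starMap {i j k : A.I} (s : A.PSec i j) (t : A.PSec j k) :
    rest (starMap s t) = rest (s.1 ≫ A.tgt i j ≫ t.1) := by
  rw [starMap_eq, rest_comp']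

theorem starMap_tgt {i j k : A.I} (s : A.PSec i j) (t : A.PSec j k) :
    starMap s t ≫ A.tgt i k = (s.1 ≫ A.tgt i j) ≫ t.1 ≫ A.tgt j k := by
  rw [starMap_eq, comp_tgt]
  simp only [Category.assoc]

/-- Composition of partial sections, in diagrammatic order. -/
noncomputable def star {i j k : A.I} (s : A.PSec i j) (t : A.PSec j k) : A.PSec i k :=
  ⟨starMap s t, by
    rw [IsPartialSection, rest_starMap, starMap_eq, comp_src, Category.assoc, s.2, rest_comm,
      rest_comp_le]⟩

variable (A) in
/-- The identity section. -/
def identSec (i : A.I) : A.PSec i i :=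
  ⟨A.ident i, by
    rw [IsPartialSection, A.str.η_src, (isTotal_ident A i).rest_eq]⟩

/-- The restriction of a partial section. -/
def restSec {i j : A.I} (s : A.PSec i j) : A.PSec i i :=
  ⟨rest s.1 ≫ A.ident i, by
    rw [IsPartialSection, Category.assoc, A.str.η_src, Category.comp_id, rest_comp_total,
      rest_rest]⟩

theorem identSec_star {i j : A.I} (s : A.PSec i j) : star (A.identSec i) s = s := by
  apply Subtype.ext
  have h : A.ident i ≫ A.tgt i i ≫ s.1 = s.1 := by
    rw [← Category.assoc, A.str.η_tgt, Category.id_comp]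
  refine Eq.trans (starMap_eq _ _) (Eq.trans (A.comp_congr (i := i) (j := i) h ?_ _)
    (A.comp_ident s.1))
  change rest (A.ident i ≫ A.tgt i i ≫ s.1) ≫ A.ident i = _
  rw [h, ← s.2, Category.assoc]

theorem star_identSec {i j : A.I} (s : A.PSec i j) : star s (A.identSec j) = s := by
  apply Subtype.ext
  refine Eq.trans (starMap_eq _ _) (Eq.trans (A.comp_congr rfl ?_ _) (A.ident_comp s.1))
  change rest (s.1 ≫ A.tgt i j ≫ A.ident j) ≫ s.1 = s.1
  rw [rest_comp_total, rest_comp]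

theorem restSec_star {i j k : A.I} (s : A.PSec i j) (t : A.PSec i k) :
    (star (restSec s) t).1 = rest s.1 ≫ t.1 := by
  have h : starMap (A.identSec i) t = t.1 := congrArg Subtype.val (identSec_star t)
  change starMap (restSec s) t = _
  conv_rhs => rw [← h]
  simp only [starMap, restSec, identSec, Category.assoc]

theorem star_assoc {i j k l : A.I} (s : A.PSec i j) (t : A.PSec j k) (u : A.PSec k l) :
    star (star s t) u = star s (star t u) := by
  apply Subtype.ext
  change starMap (star s t) u = starMap s (star t u)
  have h1 : (star s t).1 ≫ A.tgt i k ≫ u.1 = s.1 ≫ A.tgt i j ≫ t.1 ≫ A.tgt j k ≫ u.1 := by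
    have := congrArg (fun x => x ≫ u.1) (starMap_tgt s t)
    simp only [Category.assoc] at this
    exact this
  have hle : rest (s.1 ≫ A.tgt i j ≫ t.1 ≫ A.tgt j k ≫ u.1) ≫ rest (s.1 ≫ A.tgt i j ≫ t.1) =
      rest (s.1 ≫ A.tgt i j ≫ t.1 ≫ A.tgt j k ≫ u.1) := by
    have := rest_comp_le (s.1 ≫ A.tgt i j ≫ t.1) (A.tgt j k ≫ u.1)
    rw [rest_comm]
    simpa only [Category.assoc] using this
  have hw : (rest (s.1 ≫ A.tgt i j ≫ t.1 ≫ A.tgt j k ≫ u.1) ≫ s.1 ≫ A.tgt i j ≫ t.1) ≫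
      A.src j k = (rest (s.1 ≫ A.tgt i j ≫ t.1 ≫ A.tgt j k ≫ u.1) ≫ s.1) ≫ A.tgt i j := by
    rw [Category.assoc, star_cond, Category.assoc, ← Category.assoc, hle, Category.assoc]
  have hw' : (s.1 ≫ A.tgt i j ≫ t.1 ≫ A.tgt j k ≫ u.1) ≫ A.src k l =
      (rest (s.1 ≫ A.tgt i j ≫ t.1 ≫ A.tgt j k ≫ u.1) ≫ s.1 ≫ A.tgt i j ≫ t.1) ≫
        A.tgt j k := by
    have := pullSection_cond (s.1 ≫ A.tgt i j ≫ t.1 ≫ A.tgt j k) u.2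
    simpa only [Category.assoc] using this
  have h2 : rest (s.1 ≫ A.tgt i j ≫ t.1 ≫ A.tgt j k ≫ u.1) ≫ starMap s t =
      A.comp (rest (s.1 ≫ A.tgt i j ≫ t.1 ≫ A.tgt j k ≫ u.1) ≫ s.1 ≫ A.tgt i j ≫ t.1)
        (rest (s.1 ≫ A.tgt i j ≫ t.1 ≫ A.tgt j k ≫ u.1) ≫ s.1) hw := by
    rw [starMap_eq, precomp_comp]
    exact A.comp_congr rfl (by rw [← Category.assoc, hle]) _
  have h3 : s.1 ≫ A.tgt i j ≫ starMap t u =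
      A.comp (s.1 ≫ A.tgt i j ≫ t.1 ≫ A.tgt j k ≫ u.1)
        (rest (s.1 ≫ A.tgt i j ≫ t.1 ≫ A.tgt j k ≫ u.1) ≫ s.1 ≫ A.tgt i j ≫ t.1) hw' := by
    rw [starMap_eq, precomp_comp, precomp_comp]
    refine A.comp_congr rfl ?_ _
    have := congrArg (fun x => x ≫ t.1)
      (comp_rest (s.1 ≫ A.tgt i j) (t.1 ≫ A.tgt j k ≫ u.1))
    simpa only [Category.assoc] using this
  refine Eq.trans (starMap_eq _ _) (Eq.trans ?_ (starMap_eq _ _).symm)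
  refine Eq.trans (A.comp_congr h1 (Eq.trans (by rw [h1]; rfl) h2) _) ?_
  refine Eq.trans (A.comp_assoc _ _ _ hw hw') ?_
  refine A.comp_congr h3.symm ?_ _
  change _ = rest (s.1 ≫ A.tgt i j ≫ starMap t u) ≫ s.1
  rw [h3, rest_comp']

theorem star_restSec {i j k : A.I} (s : A.PSec i j) (t : A.PSec j k) :
    star s (restSec t) = star (restSec (star s t)) s := by
  apply Subtype.ext
  refine Eq.trans ?_ (restSec_star (star s t) s).symm
  refine Eq.trans (starMap_eq _ _) ?_
  have h : s.1 ≫ A.tgt i j ≫ (restSec t).1 =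
      (rest (s.1 ≫ A.tgt i j ≫ t.1) ≫ s.1) ≫ A.tgt i j ≫ A.ident j := by
    have := congrArg (fun x => x ≫ A.ident j) (comp_rest (s.1 ≫ A.tgt i j) t.1)
    simp only [Category.assoc] at this ⊢
    exact this
  have h' : rest (s.1 ≫ A.tgt i j ≫ (restSec t).1) = rest (s.1 ≫ A.tgt i j ≫ t.1) := by
    have h1 : s.1 ≫ A.tgt i j ≫ (restSec t).1 =
      ((s.1 ≫ A.tgt i j) ≫ rest t.1) ≫ A.ident j := by
      simp only [Category.assoc]; rfl
    rw [h1, rest_comp_total, rest_comp_rest, Category.assoc]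
  refine Eq.trans (A.comp_congr h (by rw [h']) _) (Eq.trans (A.ident_comp _) ?_)
  change _ = rest (starMap s t) ≫ s.1
  rw [rest_starMap]

theorem restSec_tgt {i j : A.I} (s : A.PSec i j) :
    (restSec s).1 ≫ A.tgt i i = rest (s.1 ≫ A.tgt i j) := by
  change (rest s.1 ≫ A.ident i) ≫ A.tgt i i = rest (s.1 ≫ A.tgt i j)
  rw [Category.assoc, A.str.η_tgt, Category.comp_id, rest_comp_total]

variable (A) in
/-- The objects of the externalisation are the components. -/
def Ext : Type w := A.I

noncomputable instance : Category.{v} A.Ext where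
  Hom i j := A.PSec i j
  id i := A.identSec i
  comp s t := star s t
  id_comp s := identSec_star s
  comp_id s := star_identSec s
  assoc s t u := star_assoc s t u

theorem ext_comp_val {i j k : A.Ext} (s : i ⟶ j) (t : j ⟶ k) :
    (s ≫ t).1 = starMap s t := rfl

noncomputable instance : RestrictionCategory A.Ext where
  rest s := restSec s
  rest_comp s := Subtype.ext (by
    refine Eq.trans (restSec_star s s) (RestrictionCategory.rest_comp s.1))
  rest_comm s t := Subtype.ext (by
    refine Eq.trans (restSec_star s _) (Eq.trans ?_ (restSec_star t _).symm)
    simp only [restSec]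
    rw [← Category.assoc, RestrictionCategory.rest_comm, Category.assoc])
  rest_rest_comp s t := Subtype.ext (by
    refine Eq.trans ?_ (restSec_star s _).symm
    refine Eq.trans (congrArg (fun x => rest x ≫ A.ident _) (restSec_star s t)) ?_
    simp only [restSec]
    rw [RestrictionCategory.rest_rest_comp, Category.assoc])
  comp_rest s t := star_restSec s t

variable (A) in
/-- The externalisation of a partite internal category, with its projection to `C`. -/
noncomputable def externalisation : RCatOver.{w} C where
  carrier := A.Ext
  proj :=
    { obj := fun i => A.obj i
      map := fun {i j} s => s.1 ≫ A.tgt i j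
      map_id := fun i => A.str.η_tgt i
      map_comp := fun s t => starMap_tgt s t }
  proj_rest s := restSec_tgt s

end

section

variable {A B : PCat.{w} C}

/-- The underlying map of the action of a cofunctor on partial sections. -/
noncomputable def Cofunctor.secMap (F : Cofunctor A B) {i j : A.I} (s : A.PSec i j) :
    B.obj (F.idx i) ⟶ B.arr (F.idx i) (F.idx j) :=
  pullSection (F.onObj i) s.2 ≫ F.onArr i j

theorem Cofunctor.secMap_eq (F : Cofunctor A B) {i j : A.I} (s : A.PSec i j) :
    F.secMap s = F.act (F.onObj i ≫ s.1) (rest (F.onObj i ≫ s.1))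
      (pullSection_cond _ s.2) := rfl

theorem Cofunctor.rest_act (F : Cofunctor A B) {Z : C} {i j : A.I} (a : Z ⟶ A.arr i j)
    (b : Z ⟶ B.obj (F.idx i)) (w : a ≫ A.src i j = b ≫ F.onObj i) :
    rest (F.act a b w) = rest a := by
  rw [act, rest_comp_total, rest_lift]

theorem Cofunctor.rest_secMap (F : Cofunctor A B) {i j : A.I} (s : A.PSec i j) :
    rest (F.secMap s) = rest (F.onObj i ≫ s.1) := by
  rw [secMap_eq, rest_act]

theorem Cofunctor.secMap_tgt (F : Cofunctor A B) {i j : A.I} (s : A.PSec i j) :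
    F.secMap s ≫ B.tgt (F.idx i) (F.idx j) ≫ F.onObj j = F.onObj i ≫ s.1 ≫ A.tgt i j := by
  rw [secMap_eq, act_tgt, Category.assoc]

/-- The action of a cofunctor on partial sections. -/
noncomputable def Cofunctor.onSec (F : Cofunctor A B) {i j : A.I} (s : A.PSec i j) :
    B.PSec (F.idx i) (F.idx j) :=
  ⟨F.secMap s, by
    rw [IsPartialSection, rest_secMap, secMap_eq, act_src]⟩

theorem Cofunctor.onSec_ident (F : Cofunctor A B) (i : A.I) :
    F.onSec (A.identSec i) = B.identSec (F.idx i) := by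
  apply Subtype.ext
  refine Eq.trans (F.secMap_eq _) ?_
  refine Eq.trans (F.act_congr (b' := 𝟙 _) (Category.id_comp _).symm ?_ _)
    (Eq.trans (F.act_ident (𝟙 _)) (Category.id_comp _))
  exact (isTotal_comp (F.onObj i) (A.ident i)).rest_eq

theorem Cofunctor.onSec_rest (F : Cofunctor A B) {i j : A.I} (s : A.PSec i j) :
    F.onSec (restSec s) = restSec (F.onSec s) := by
  apply Subtype.ext
  have h : F.onObj i ≫ (restSec s).1 =
      rest (F.onObj i ≫ s.1) ≫ F.onObj i ≫ A.ident i := by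
    have := congrArg (fun x => x ≫ A.ident i) (comp_rest (F.onObj i) s.1)
    simp only [Category.assoc] at this
    exact this
  have h' : rest (F.onObj i ≫ (restSec s).1) = rest (F.onObj i ≫ s.1) := by
    have h1 : F.onObj i ≫ (restSec s).1 = (F.onObj i ≫ rest s.1) ≫ A.ident i := by
      rw [Category.assoc]; rfl
    rw [h1, rest_comp_total, rest_comp_rest]
  refine Eq.trans (F.secMap_eq _) (Eq.trans (F.act_congr h h' _) (Eq.trans (F.act_ident _) ?_))
  change _ = rest (F.secMap s) ≫ _
  rw [rest_secMap]

theorem Cofunctor.onSec_star (F : Cofunctor A B) {i j k : A.I} (s : A.PSec i j)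
    (t : A.PSec j k) : F.onSec (star s t) = star (F.onSec s) (F.onSec t) := by
  apply Subtype.ext
  set e := rest (F.onObj i ≫ s.1 ≫ A.tgt i j ≫ t.1) with he
  have hle : e ≫ rest (F.onObj i ≫ s.1) = e := by
    have := rest_comp_le (F.onObj i ≫ s.1) (A.tgt i j ≫ t.1)
    rw [rest_comm]
    simpa only [Category.assoc] using this
  have hw : (e ≫ F.onObj i ≫ s.1) ≫ A.src i j = e ≫ F.onObj i := by
    rw [Category.assoc, pullSection_cond (F.onObj i) s.2, ← Category.assoc, hle]
  have hw' : (F.onObj i ≫ s.1 ≫ A.tgt i j ≫ t.1) ≫ A.src j k =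
      (e ≫ F.onObj i ≫ s.1) ≫ A.tgt i j := by
    have := pullSection_cond (F.onObj i ≫ s.1 ≫ A.tgt i j) t.2
    simpa only [Category.assoc] using this
  have h1 : F.onObj i ≫ starMap s t =
      A.comp (F.onObj i ≫ s.1 ≫ A.tgt i j ≫ t.1) (e ≫ F.onObj i ≫ s.1) hw' := by
    rw [starMap_eq, precomp_comp]
    refine A.comp_congr rfl ?_ _
    have := congrArg (fun x => x ≫ s.1) (comp_rest (F.onObj i) (s.1 ≫ A.tgt i j ≫ t.1))
    simpa only [Category.assoc] using this
  have h2 : rest (F.onObj i ≫ starMap s t) = e := by rw [h1, rest_comp']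
  have h3 : F.act (e ≫ F.onObj i ≫ s.1) e hw = e ≫ F.secMap s := by
    rw [secMap_eq, precomp_act]
    exact F.act_congr rfl hle.symm _
  have h4 : (F.onSec s).1 ≫ B.tgt (F.idx i) (F.idx j) ≫ F.onObj j ≫ t.1 =
      F.onObj i ≫ s.1 ≫ A.tgt i j ≫ t.1 := by
    have := congrArg (fun x => x ≫ t.1) (F.secMap_tgt s)
    simp only [Category.assoc] at this
    exact this
  have h5 : (F.onSec s).1 ≫ B.tgt (F.idx i) (F.idx j) ≫ rest (F.onObj j ≫ t.1) =
      F.act (e ≫ F.onObj i ≫ s.1) e hw ≫ B.tgt (F.idx i) (F.idx j) := by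
    have := comp_rest ((F.onSec s).1 ≫ B.tgt (F.idx i) (F.idx j)) (F.onObj j ≫ t.1)
    simp only [Category.assoc] at this
    rw [this, h4, h3, Category.assoc]
    rfl
  refine Eq.trans (F.secMap_eq _) (Eq.trans ?_ (starMap_eq _ _).symm)
  refine Eq.trans (F.act_congr h1 h2 _) (Eq.trans (F.act_comp _ _ _ hw hw') ?_)
  have h6 : (F.onSec s).1 ≫ B.tgt (F.idx i) (F.idx j) ≫ (F.onSec t).1 =
      F.act (F.onObj i ≫ s.1 ≫ A.tgt i j ≫ t.1)
        (F.act (e ≫ F.onObj i ≫ s.1) e hw ≫ B.tgt (F.idx i) (F.idx j))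
        (by rw [hw', Category.assoc (F.act _ _ _), act_tgt]) := by
    change (F.onSec s).1 ≫ B.tgt (F.idx i) (F.idx j) ≫ F.secMap t = _
    rw [secMap_eq, precomp_act, precomp_act]
    exact F.act_congr h4 h5 _
  refine B.comp_congr h6.symm ?_ _
  rw [h6, rest_act, h3]
  rfl

/-- The lax triangle induced by a cofunctor. -/
noncomputable def Cofunctor.externalisation (F : Cofunctor A B) :
    RCatOver.Hom A.externalisation B.externalisation where
  functor :=
    { obj := fun i => F.idx i
      map := fun s => F.onSec s
      map_id := fun i => F.onSec_ident i
      map_comp := fun s t => F.onSec_star s t }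
  map_rest s := F.onSec_rest s
  nat :=
    { app := fun i => F.onObj i
      naturality := fun i j s => by
        refine Eq.trans ?_ (F.secMap_tgt s)
        exact Category.assoc (F.secMap s) (B.tgt (F.idx i) (F.idx j)) (F.onObj j) }
  nat_total i := F.onObj_total i

end

theorem onSec_id {A : PCat.{w} C} {i j : A.I} (s : A.PSec i j) :
    (Cofunctor.id A).onSec s = s := by
  apply Subtype.ext
  exact Eq.trans (pullback.lift_fst (f := A.src i j) (g := 𝟙 (A.obj i)) _ _ _)
    (Category.id_comp _)

theorem onSec_comp {A B D : PCat.{w} C} (F : Cofunctor A B) (G : Cofunctor B D) {i j : A.I}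
    (s : A.PSec i j) : (Cofunctor.comp F G).onSec s = G.onSec (F.onSec s) := by
  apply Subtype.ext
  refine Eq.trans (Cofunctor.lift_compArr F G _ _ _) ?_
  refine Eq.trans ?_ (G.secMap_eq _).symm
  have h : G.onObj (F.idx i) ≫ (F.onSec s).1 =
      F.act ((G.onObj (F.idx i) ≫ F.onObj i) ≫ s.1)
        (rest ((G.onObj (F.idx i) ≫ F.onObj i) ≫ s.1) ≫ G.onObj (F.idx i))
        (by rw [pullSection_cond _ s.2]; simp only [Category.assoc]) := by
    change G.onObj (F.idx i) ≫ F.secMap s = _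
    rw [Cofunctor.secMap_eq, Cofunctor.precomp_act]
    refine F.act_congr (Category.assoc _ _ _).symm ?_ _
    rw [comp_rest, Category.assoc]
  refine G.act_congr h.symm ?_ _
  rw [h, Cofunctor.rest_act]
  rfl

variable (C) in
/-- The externalisation functor. -/
noncomputable def Phi : PCat.{w} C ⥤ RCatOver.{w} C where
  obj A := A.externalisation
  map F := Cofunctor.externalisation F
  map_id _ := RCatOver.Hom.ext_of _ _
    (Functor.hext (fun _ => rfl) fun _ _ s => heq_of_eq (onSec_id s)) fun _ => HEq.rfl
  map_comp F G := RCatOver.Hom.ext_of _ _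
    (Functor.hext (fun _ => rfl) fun _ _ s => heq_of_eq (onSec_comp F G s)) fun _ => HEq.rfl

end PCat

/-! ### Internalisation -/

namespace RCatOver

variable {C : Type u} [Category.{v} C] [RestrictionCategory C]

section

variable (P : RCatOver.{w} C)

/-- The maps `P e` for `e` a restriction idempotent with `e ≤ rest f ≫ rest g` on which `f` and
`g` agree. -/
def agreeSet {i j : P.carrier} (f g : i ⟶ j) : Set (P.proj.obj i ⟶ P.proj.obj i) :=
  { φ | ∃ e : i ⟶ i, IsRestIdem e ∧ Le e (rest f ≫ rest g) ∧ e ≫ f = e ≫ g ∧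
    φ = P.proj.map e }

theorem rest_of_mem_agreeSet {i j : P.carrier} {f g : i ⟶ j}
    {φ : P.proj.obj i ⟶ P.proj.obj i} (hφ : φ ∈ P.agreeSet f g) : rest φ = φ := by
  obtain ⟨e, he, -, -, rfl⟩ := hφ
  rw [← P.proj_rest, (isRestIdem_iff e).1 he]

theorem compat_agreeSet {i j : P.carrier} (f g : i ⟶ j) :
    ∀ φ ∈ P.agreeSet f g, ∀ ψ ∈ P.agreeSet f g, Compat φ ψ := by
  intro φ hφ ψ hψ
  have h := rest_comm φ ψ
  rw [P.rest_of_mem_agreeSet hφ, P.rest_of_mem_agreeSet hψ] at h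
  rw [Compat, P.rest_of_mem_agreeSet hφ, P.rest_of_mem_agreeSet hψ, h]

variable [IsJoinRestriction C]

/-- The `P`-valued equality of parallel maps: the join of `agreeSet f g`. -/
noncomputable def valuedEq {i j : P.carrier} (f g : i ⟶ j) : P.proj.obj i ⟶ P.proj.obj i :=
  Classical.choose (IsJoinRestriction.exists_join _ (P.compat_agreeSet f g))

theorem isJoin_valuedEq {i j : P.carrier} (f g : i ⟶ j) :
    IsJoin (P.agreeSet f g) (P.valuedEq f g) :=
  Classical.choose_spec (IsJoinRestriction.exists_join _ (P.compat_agreeSet f g))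

/-- A choice, for all `i` and `j`, of a glueing of the local atlas on `P i` given by the
`P`-valued equalities of the maps from `i` to `j`. -/
abbrev Glueings : Type (max w u v) :=
  ∀ i j : P.carrier, Glueing (fun f g : i ⟶ j => P.valuedEq f g)

end

section

variable {P : RCatOver.{w} C} [IsJoinRestriction C]

/-- The partite internal category on the glueings `g` with structure `S`. -/
def Glueings.toPCat (g : P.Glueings) (S : PartiteStr fun i j => (g i j).p) :
    PCat.{w} C where
  I := P.carrier
  obj i := P.proj.obj i
  arr i j := (g i j).A
  src i j := (g i j).p
  str := S

/-- The basic partial sections of the source maps. -/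
def Glueings.sec (g : P.Glueings) (S : PartiteStr fun i j => (g i j).p) {i j : P.carrier}
    (f : i ⟶ j) : (g.toPCat S).PSec i j :=
  ⟨(g i j).sec f, (g i j).sec_isPartialSection f⟩

/-- The equations that determine the target, identity and composition maps of the
internalisation of `P` from those of `P`; the last one says that the composite of `s_f`, the
pullback of `s_h` along the target map, and the composition map, is the section of `f ≫ h`. -/
structure Glueings.IsInternalisation (g : P.Glueings)
    (S : PartiteStr fun i j => (g i j).p) : Prop where
  tgt : ∀ {i j : P.carrier} (f : i ⟶ j), (g i j).sec f ≫ S.τ i j = P.proj.map f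
  ident : ∀ i : P.carrier, S.η i = (g i i).sec (𝟙 i)
  comp : ∀ {i j k : P.carrier} (f : i ⟶ j) (h : j ⟶ k),
    PCat.starMap (g.sec S f) (g.sec S h) = (g i k).sec (f ≫ h)

end

/-- An internalisation of `P`: glueings of the local atlases given by the `P`-valued equalities,
with the structure of a partite internal category induced by that of `P`. -/
structure Internalisation (P : RCatOver.{w} C) [IsJoinRestriction C] where
  glueings : P.Glueings
  str : PartiteStr fun i j => (glueings i j).p
  isInternalisation : glueings.IsInternalisation str

namespace Internalisation

variable {P : RCatOver.{w} C} [IsJoinRestriction C] (N : P.Internalisation)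

/-- The internalisation as a partite internal category. -/
def toPCat : PCat.{w} C := N.glueings.toPCat N.str

theorem sec_rest {i j : P.carrier} (f : i ⟶ j) :
    (N.glueings i i).sec (rest f) =
      rest ((N.glueings i j).sec f) ≫ (N.glueings i i).sec (𝟙 i) := by
  have hself : ∀ {i j : P.carrier} (f : i ⟶ j),
      rest ((N.glueings i j).sec f) = P.proj.map (rest f) := by
    intro i j f
    rw [← ((N.glueings i j).isPartialInverse f).2, (N.glueings i j).induces]
    have hj := P.isJoin_valuedEq f f
    have hmem : P.proj.map (rest f) ∈ P.agreeSet f f :=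
      ⟨rest f, ⟨_, f, rfl⟩, by rw [Le, rest_idem, rest_rest, rest_idem], rfl, rfl⟩
    have hub : ∀ φ ∈ P.agreeSet f f, Le φ (P.proj.map (rest f)) := by
      rintro φ ⟨e, -, h, -, rfl⟩
      rw [Le, rest_idem] at h
      rw [Le, ← P.proj_rest, ← P.proj.map_comp, ← h]
    exact le_antisymm' (hj.2 _ hub) (hj.1 _ hmem)
  have hval : P.valuedEq (rest f) (𝟙 i) = P.proj.map (rest f) := by
    have hj := P.isJoin_valuedEq (rest f) (𝟙 i)
    have hmem : P.proj.map (rest f) ∈ P.agreeSet (rest f) (𝟙 i) :=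
      ⟨rest f, ⟨_, f, rfl⟩, by rw [Le, rest_rest, rest_id, Category.comp_id, rest_idem],
        by rw [rest_idem, Category.comp_id], rfl⟩
    have hub : ∀ φ ∈ P.agreeSet (rest f) (𝟙 i), Le φ (P.proj.map (rest f)) := by
      rintro φ ⟨e, -, h, -, rfl⟩
      rw [Le, rest_rest, rest_id, Category.comp_id] at h
      rw [Le, ← P.proj_rest, ← P.proj.map_comp, ← h]
    exact le_antisymm' (hj.2 _ hub) (hj.1 _ hmem)
  have hind := (N.glueings i i).induces (rest f) (𝟙 i)
  rw [hval] at hind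
  have h1 := ((N.glueings i i).isPartialInverse (𝟙 i)).1
  have h2 : rest ((N.glueings i i).sec (rest f)) = P.proj.map (rest f) := by
    rw [hself, rest_rest]
  have h3 : P.proj.map (rest f) ≫ (N.glueings i i).sec (𝟙 i) =
      P.proj.map (rest f) ≫ (N.glueings i i).sec (rest f) := by
    conv_lhs => rw [← hind, Category.assoc, h1, comp_rest, hind, ← P.proj_rest, rest_rest]
  rw [hself, h3, ← h2, rest_comp]

/-- The unit functor `f ↦ s_f` with the identity transformation, as a lax triangle. -/
noncomputable def unitHom : RCatOver.Hom P N.toPCat.externalisation where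
  functor :=
    { obj := fun i => i
      map := fun f => N.glueings.sec N.str f
      map_id := fun i => Subtype.ext (N.isInternalisation.ident i).symm
      map_comp := fun f h => Subtype.ext (N.isInternalisation.comp f h).symm }
  map_rest {i j} f := Subtype.ext (by
    refine (N.sec_rest f).trans ?_
    rw [← N.isInternalisation.ident i]
    rfl)
  nat :=
    { app := fun i => 𝟙 (P.proj.obj i)
      naturality := fun i j f =>
        (Category.comp_id _).trans ((N.isInternalisation.tgt f).trans (Category.id_comp _).symm) }
  nat_total _ := isTotal_id _

/-- The unit map at `P`. -/
noncomputable def unit : P ⟶ (PCat.Phi C).obj N.toPCat := N.unitHom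

end Internalisation

end RCatOver

/-!
The idea is that a local homeomorphism `p : A ⟶ X` is the colimit of its charts. If `p` is the join
of partial isomorphisms `part i` with partial inverses `sec i`, then `𝟙 A` is the join of the
idempotents `rest (part i) = part i ≫ sec i`, and joins are preserved by composition on both
sides. Hence the sections `sec i` are jointly epimorphic (`LocalHomeo.hom_ext`), and a family of
maps out of `X` that is compatible with the matrix `sec i ≫ part j` descends to `A`
(`LocalHomeo.exists_desc`). Local homeomorphisms compose and are stable under pullback along total
maps; in the presence of local glueings these pullbacks exist, being glueings of the pulled back
matrices (`LocalHomeo.isCarrable`).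

For `P` over `C`, the valued equalities of maps from `i` to `j` form a local atlas, and its glueing
has one section for each `f : i ⟶ j`. The objects of composable pairs and triples of the
internalisation, and the domains occurring in the axioms of a cofunctor out of it, are pullbacks
and composites of these glueings. They are therefore local homeomorphisms over an object of
objects, with one section for each map, composable pair or composable triple of `P`. So every
structure map is determined by its values on these sections, and every law needs to be checked on
them only, where it becomes a law of the category `P` or the functoriality or naturality of a map
`P ⟶ Φ B`. Existence of the structure maps reduces to compatibility with the matrices: for the
target and composition maps this says that valued equality is a congruence
(`RCatOver.valuedEq_comp_map`, `RCatOver.valuedEq_comp_le`), and for the cofunctor induced by a map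
`P ⟶ Φ B` it says that the latter respects valued equality (`RCatOver.Hom.valuedEq_comp_secMap`).
The resulting bijections, natural in `B`, assemble into the adjunction.
-/

/-! ### Joins of parallel maps -/

namespace RestrictionCategory

section

variable {C : Type u} [Category.{v} C] [RestrictionCategory C]

theorem Le.trans {A B : C} {f g h : A ⟶ B} (h₁ : Le f g) (h₂ : Le g h) : Le f h := by
  have e : rest f = rest f ≫ rest g := by
    rw [← rest_rest_comp, ← h₁]
  calc f = rest f ≫ g := h₁
    _ = rest f ≫ rest g ≫ h := congrArg (rest f ≫ ·) h₂
    _ = rest f ≫ h := by rw [← Category.assoc, ← e]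

theorem Le.comp_right {A B D : C} {f g : A ⟶ B} (h : Le f g) (x : B ⟶ D) :
    Le (f ≫ x) (g ≫ x) := by
  have e : f ≫ x = rest f ≫ g ≫ x := by rw [← Category.assoc, ← h]
  calc f ≫ x = rest (f ≫ x) ≫ f ≫ x := (rest_comp _).symm
    _ = (rest (f ≫ x) ≫ rest f) ≫ g ≫ x := by rw [Category.assoc, ← e]
    _ = rest (f ≫ x) ≫ g ≫ x := by rw [rest_comm, rest_comp_le]

theorem Le.comp_left {A B D : C} {f g : A ⟶ B} (h : Le f g) (x : D ⟶ A) :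
    Le (x ≫ f) (x ≫ g) := by
  have e : x ≫ f = x ≫ rest f ≫ g := congrArg (x ≫ ·) h
  rw [Le, e]
  conv_lhs => rw [← Category.assoc, comp_rest, Category.assoc]
  rw [← e]

theorem Le.rest_eq {A B : C} {f g : A ⟶ B} (h : Le f g) : rest f = rest f ≫ rest g := by
  rw [← rest_rest_comp, ← h]

theorem Le.rest_le {A B : C} {f g : A ⟶ B} (h : Le f g) : Le (rest f) (rest g) := by
  rw [Le, rest_rest, ← h.rest_eq]

theorem rest_comp_left_le {A B D : C} (f : A ⟶ D) (g : A ⟶ B) : Le (rest f ≫ g) g := by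
  rw [Le, rest_rest_comp, Category.assoc, rest_comp]

theorem Compat.of_le {A B : C} {f g h : A ⟶ B} (hf : Le f h) (hg : Le g h) : Compat f g := by
  have e₁ : rest g ≫ f = rest g ≫ rest f ≫ h := congrArg (rest g ≫ ·) hf
  have e₂ : rest f ≫ g = rest f ≫ rest g ≫ h := congrArg (rest f ≫ ·) hg
  rw [Compat, e₁, e₂, ← Category.assoc, rest_comm, Category.assoc]

/-- Two parallel maps below a common map are equal as soon as their restrictions are. -/
theorem Le.eq_of_rest_eq {A B : C} {f g : A ⟶ B} (h : Le f g) (e : rest f = rest g) : f = g := by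
  rw [h, e, rest_comp]

theorem IsJoin.unique {A B : C} {S : Set (A ⟶ B)} {h k : A ⟶ B} (hh : IsJoin S h)
    (hk : IsJoin S k) : h = k :=
  le_antisymm' (hh.2 _ hk.1) (hk.2 _ hh.1)

theorem IsJoin.compat {A B : C} {S : Set (A ⟶ B)} {h : A ⟶ B} (hh : IsJoin S h) :
    ∀ f ∈ S, ∀ g ∈ S, Compat f g :=
  fun _ hf _ hg => Compat.of_le (hh.1 _ hf) (hh.1 _ hg)

variable [IsJoinRestriction C]

theorem IsJoin.comp_left {A B D : C} {S : Set (A ⟶ B)} {h : A ⟶ B} (hh : IsJoin S h)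
    (a : D ⟶ A) : IsJoin ((fun f => a ≫ f) '' S) (a ≫ h) :=
  IsJoinRestriction.comp_join a S h hh.compat hh

/-- Preservation of joins by postcomposition follows from preservation by precomposition: writing
`k` for the join of the maps `f ≫ x`, the restriction of `h ≫ x` is absorbed by that of `k`
because `rest (h ≫ x) ≫ h` is the join of the maps `rest (h ≫ x) ≫ f`. -/
theorem IsJoin.comp_right {A B D : C} {S : Set (A ⟶ B)} {h : A ⟶ B} (hh : IsJoin S h)
    (x : B ⟶ D) : IsJoin ((fun f => f ≫ x) '' S) (h ≫ x) := by
  have hub : ∀ f' ∈ (fun f => f ≫ x) '' S, Le f' (h ≫ x) := by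
    rintro _ ⟨f, hf, rfl⟩
    exact (hh.1 f hf).comp_right x
  obtain ⟨k, hk⟩ := IsJoinRestriction.exists_join ((fun f => f ≫ x) '' S)
    (fun f hf g hg => Compat.of_le (hub f hf) (hub g hg))
  have hkle : Le k (h ≫ x) := hk.2 _ hub
  have h1 : Le (rest (h ≫ x) ≫ h) (rest k ≫ h) := by
    refine (hh.comp_left (rest (h ≫ x))).2 _ ?_
    rintro _ ⟨f, hf, rfl⟩
    have e : rest (h ≫ x) ≫ f = rest (f ≫ x) ≫ h := by
      have e1 : rest (h ≫ x) ≫ f = rest (h ≫ x) ≫ rest f ≫ h :=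
        congrArg (rest (h ≫ x) ≫ ·) (hh.1 f hf)
      have e2 : rest f ≫ h ≫ x = f ≫ x := by
        rw [← Category.assoc, ← hh.1 f hf]
      rw [e1, ← Category.assoc, rest_comm, ← rest_rest_comp, e2]
    have e' : rest (f ≫ x) = rest (f ≫ x) ≫ rest k := (hk.1 _ ⟨f, hf, rfl⟩).rest_eq
    change Le (rest (h ≫ x) ≫ f) _
    rw [e, e', Category.assoc]
    exact rest_comp_left_le _ _
  have e : k = h ≫ x := by
    refine hkle.eq_of_rest_eq ?_
    have e3 : rest (h ≫ x) ≫ rest h = rest (h ≫ x) := by rw [rest_comm, rest_comp_le]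
    have e4 := h1.rest_eq
    rw [rest_rest_comp, rest_rest_comp, e3, rest_comm k h, ← Category.assoc, e3] at e4
    rw [hkle.rest_eq, rest_comm, ← e4]
  rw [← e]
  exact hk

theorem IsJoin.comp_left_range {A B D : C} {ι : Type*} {f : ι → (A ⟶ B)} {h : A ⟶ B}
    (hh : IsJoin (Set.range f) h) (a : D ⟶ A) :
    IsJoin (Set.range fun i => a ≫ f i) (a ≫ h) := by
  have := hh.comp_left a
  rwa [← Set.range_comp] at this

theorem IsJoin.comp_right_range {A B D : C} {ι : Type*} {f : ι → (A ⟶ B)} {h : A ⟶ B}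
    (hh : IsJoin (Set.range f) h) (x : B ⟶ D) :
    IsJoin (Set.range fun i => f i ≫ x) (h ≫ x) := by
  have := hh.comp_right x
  rwa [← Set.range_comp] at this

/-- Parallel maps `a ≫ h ≫ x` and `a ≫ h ≫ y` through a join `h` may be compared on the members of
the joined family. -/
theorem IsJoin.hom_ext {A B D E : C} {S : Set (A ⟶ B)} {h : A ⟶ B} (hh : IsJoin S h)
    (a : D ⟶ A) (x y : B ⟶ E) (H : ∀ f ∈ S, a ≫ f ≫ x = a ≫ f ≫ y) :
    a ≫ h ≫ x = a ≫ h ≫ y := by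
  have hx := (hh.comp_right x).comp_left a
  have hy := (hh.comp_right y).comp_left a
  rw [Set.image_image] at hx hy
  rw [Set.image_congr H] at hx
  exact hx.unique hy

/-- Taking restrictions preserves joins: if `j` is the join of the idempotents `rest f`, then `j ≫ h`
is the join of the maps `rest f ≫ h = f`, so that `j ≫ h = h` and `rest h` is below `j`. -/
theorem IsJoin.rest {A B : C} {S : Set (A ⟶ B)} {h : A ⟶ B} (hh : IsJoin S h) :
    IsJoin ((fun f => rest f) '' S) (rest h) := by
  have hub : ∀ e ∈ (fun f => RestrictionCategory.rest f) '' S,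
      Le e (RestrictionCategory.rest h) := by
    rintro _ ⟨f, hf, rfl⟩
    exact (hh.1 f hf).rest_le
  obtain ⟨j, hj⟩ := IsJoinRestriction.exists_join _
    (fun f hf g hg => Compat.of_le (hub f hf) (hub g hg))
  have hj' := hj.comp_right h
  rw [Set.image_image, Set.image_congr (g := fun f => f) (fun f hf => (hh.1 f hf).symm),
    Set.image_id'] at hj'
  have e : j ≫ h = h := hj'.unique hh
  have hle : Le j (RestrictionCategory.rest h) := hj.2 _ hub
  have e1 : j = RestrictionCategory.rest h := by
    refine hle.eq_of_rest_eq ?_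
    rw [rest_rest, hle.rest_eq, rest_rest, rest_comm, ← e]
    conv_lhs => rw [e]
    conv_rhs => rw [← rest_comp_le]
    rw [e, rest_comm]
  rwa [← e1]

theorem IsJoin.rest_range {A B : C} {ι : Type*} {f : ι → (A ⟶ B)} {h : A ⟶ B}
    (hh : IsJoin (Set.range f) h) :
    IsJoin (Set.range fun i => RestrictionCategory.rest (f i)) (RestrictionCategory.rest h) := by
  have := hh.rest
  rwa [← Set.range_comp] at this

theorem IsJoin.comp_range {A B D : C} {ι κ : Type*} {f : ι → (A ⟶ B)} {g : κ → (B ⟶ D)}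
    {h : A ⟶ B} {k : B ⟶ D} (hh : IsJoin (Set.range f) h) (hk : IsJoin (Set.range g) k) :
    IsJoin (Set.range fun x : ι × κ => f x.1 ≫ g x.2) (h ≫ k) := by
  constructor
  · rintro _ ⟨⟨i, j⟩, rfl⟩
    exact ((hh.1 _ ⟨i, rfl⟩).comp_right _).trans ((hk.1 _ ⟨j, rfl⟩).comp_left _)
  · intro m hm
    refine (hh.comp_right_range k).2 _ ?_
    rintro _ ⟨i, rfl⟩
    refine (hk.comp_left_range (f i)).2 _ ?_
    rintro _ ⟨j, rfl⟩
    exact hm _ ⟨(i, j), rfl⟩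

end

end RestrictionCategory

/-! ### Local homeomorphisms -/

/-- A presentation of `p` as a local homeomorphism: `p` is total and is the join of partial
isomorphisms `part i` with partial inverses `sec i`. A glueing is such a presentation with a
prescribed matrix `sec i ≫ part j`. -/
structure LocalHomeo {C : Type u} [Category.{v} C] [RestrictionCategory C] {A X : C} (I : Type w)
    (p : A ⟶ X) where
  part : I → (A ⟶ X)
  sec : I → (X ⟶ A)
  total : IsTotal p
  isPartialInverse : ∀ i, IsPartialInverse (part i) (sec i)
  isJoin : IsJoin (Set.range part) p

/-- The presentation underlying a glueing. -/
def Glueing.toLocalHomeo {C : Type u} [Category.{v} C] [RestrictionCategory C] {X : C}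
    {I : Type v} {φ : I → I → (X ⟶ X)} (g : Glueing φ) : LocalHomeo I g.p where
  part := g.part
  sec := g.sec
  total := g.total
  isPartialInverse := g.isPartialInverse
  isJoin := g.isJoin

namespace LocalHomeo

variable {C : Type u} [Category.{v} C] [RestrictionCategory C] {A X : C} {I : Type w}
  {p : A ⟶ X}

section

variable (L : LocalHomeo I p)

theorem part_eq (i : I) : L.part i = rest (L.part i) ≫ p := L.isJoin.1 _ ⟨i, rfl⟩

theorem part_sec (i : I) : L.part i ≫ L.sec i = rest (L.part i) := (L.isPartialInverse i).1

theorem sec_part (i : I) : L.sec i ≫ L.part i = rest (L.sec i) := (L.isPartialInverse i).2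

theorem sec_rest_part (i : I) : L.sec i ≫ rest (L.part i) = L.sec i := by
  rw [← L.part_sec, ← Category.assoc, L.sec_part, rest_comp]

theorem sec_isPartialSection (i : I) : IsPartialSection p (L.sec i) := by
  rw [IsPartialSection, ← L.sec_rest_part, Category.assoc, ← L.part_eq, L.sec_part,
    L.sec_rest_part]

theorem rest_matrix (i j : I) : rest (L.sec i ≫ L.part j) = L.sec i ≫ L.part j := by
  have e : L.sec i ≫ L.part j = rest (L.sec i ≫ L.part j) ≫ rest (L.sec i) := by
    conv_lhs => rw [L.part_eq j, ← Category.assoc, comp_rest, Category.assoc,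
      L.sec_isPartialSection i]
  rw [rest_comm, rest_comp_le] at e
  exact e.symm

/-- Entries of the matrix equalise the corresponding sections. -/
theorem matrix_comp_sec (i j : I) :
    (L.sec i ≫ L.part j) ≫ L.sec j = (L.sec i ≫ L.part j) ≫ L.sec i := by
  conv_lhs => rw [Category.assoc, L.part_sec, comp_rest, L.rest_matrix]

theorem matrix_comp_matrix (i j k : I) :
    (L.sec i ≫ L.part j) ≫ L.sec j ≫ L.part k = (L.sec i ≫ L.part j) ≫ L.sec i ≫ L.part k := by
  rw [← Category.assoc, L.matrix_comp_sec, Category.assoc]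

theorem matrix_symm (i j : I) : L.sec i ≫ L.part j = L.sec j ≫ L.part i := by
  have h : ∀ i j, (L.sec i ≫ L.part j) ≫ L.sec j ≫ L.part i = L.sec i ≫ L.part j := by
    intro i j
    rw [L.matrix_comp_matrix, L.sec_part]
    nth_rewrite 1 [← L.rest_matrix]
    rw [rest_comm, rest_comp_le, L.rest_matrix]
  rw [← h i j, ← L.rest_matrix i j, ← L.rest_matrix j i, rest_comm, L.rest_matrix i j,
    L.rest_matrix j i, h j i]

variable [IsJoinRestriction C]

theorem isJoin_rest_part : IsJoin (Set.range fun i => rest (L.part i)) (𝟙 A) := by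
  rw [← L.total.rest_eq]
  exact L.isJoin.rest_range

/-- The sections of a local homeomorphism are jointly epimorphic. -/
theorem hom_ext (L : LocalHomeo I p) {Z : C} {u v : A ⟶ Z} (h : ∀ i, L.sec i ≫ u = L.sec i ≫ v) : u = v := by
  have := L.isJoin_rest_part.hom_ext (𝟙 A) u v (by
    rintro _ ⟨i, rfl⟩
    simp only [← L.part_sec, Category.assoc, h])
  simpa using this

theorem total_of_sec (L : LocalHomeo I p) {Z : C} {u : A ⟶ Z} (h : ∀ i, rest (L.sec i ≫ u) = rest (L.sec i)) :
    IsTotal u := by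
  refine ⟨L.hom_ext fun i => ?_⟩
  rw [comp_rest, h, rest_comp, Category.comp_id]

/-- A local homeomorphism is the colimit of its charts: a family of maps out of the base that is
compatible with the matrix descends to the total space. -/
theorem exists_desc {Z : C} (u : I → (X ⟶ Z))
    (h : ∀ i j, (L.sec i ≫ L.part j) ≫ u j = (L.sec i ≫ L.part j) ≫ u i) :
    ∃ d : A ⟶ Z, ∀ i, L.sec i ≫ d = rest (L.sec i) ≫ u i := by
  have h1 : ∀ i j, rest (L.part j) ≫ L.part i ≫ u i = rest (L.part i) ≫ L.part j ≫ u j := by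
    intro i j
    have e : rest (L.part j) ≫ L.part i = rest (L.part i) ≫ L.part j := by
      conv_lhs => rw [L.part_eq i, ← Category.assoc, rest_comm, Category.assoc, ← L.part_eq j]
    have e1 := congrArg (fun x => L.part j ≫ x) (h j i)
    have e2 : L.part j ≫ L.sec j ≫ L.part i = rest (L.part i) ≫ L.part j := by
      rw [← Category.assoc, L.part_sec, e]
    simp only [← Category.assoc] at e1
    rw [Category.assoc (L.part j), e2] at e1
    rw [← Category.assoc, e, e1, Category.assoc]
  have h2 : ∀ i j, rest (L.part j ≫ u j) ≫ L.part i ≫ u i =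
      rest (L.part i) ≫ L.part j ≫ u j := by
    intro i j
    rw [← rest_comp_le, rest_comm, Category.assoc, h1, ← Category.assoc, rest_comm,
      Category.assoc, rest_comp]
  -- the descended map is the join of the maps `L.part i ≫ u i`
  obtain ⟨d, hd⟩ := IsJoinRestriction.exists_join (Set.range fun i => L.part i ≫ u i) (by
    rintro _ ⟨i, rfl⟩ _ ⟨j, rfl⟩
    rw [Compat, h2, h2, h1])
  refine ⟨d, fun i => le_antisymm' ?_ ?_⟩
  · refine (hd.comp_left_range (L.sec i)).2 _ ?_
    rintro _ ⟨j, rfl⟩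
    have e : L.sec i ≫ L.part j ≫ u j = rest (L.sec i ≫ L.part j) ≫ rest (L.sec i) ≫ u i := by
      rw [← Category.assoc, h, ← Category.assoc (rest _), rest_comm (L.sec i ≫ L.part j),
        rest_comp_le, L.rest_matrix]
    dsimp only
    rw [e]
    exact rest_comp_left_le _ _
  · rw [← L.sec_part, Category.assoc]
    exact (hd.1 _ ⟨i, rfl⟩).comp_left _

end

variable [IsJoinRestriction C]

/-- Local homeomorphisms compose. -/
def comp {Y : C} {J : Type*} {q : X ⟶ Y} (L : LocalHomeo I p) (M : LocalHomeo J q) :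
    LocalHomeo (I × J) (p ≫ q) where
  part x := L.part x.1 ≫ M.part x.2
  sec x := M.sec x.2 ≫ L.sec x.1
  total := by
    have := L.total
    have := M.total
    infer_instance
  isPartialInverse x := by
    constructor
    · rw [Category.assoc, ← Category.assoc (M.part x.2), M.part_sec, ← Category.assoc, comp_rest,
        Category.assoc, L.part_sec, rest_comm, rest_comp_le]
    · rw [Category.assoc, ← Category.assoc (L.sec x.1), L.sec_part, ← Category.assoc, comp_rest,
        Category.assoc, M.sec_part, rest_comm, rest_comp_le]
  isJoin := L.isJoin.comp_range M.isJoin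

/-- Local homeomorphisms are stable under pullback along total maps; the sections of the pullback
are the pullbacks of the sections. -/
noncomputable def pullback {Y : C} (L : LocalHomeo I p) (f : Y ⟶ X) [IsTotal p] [IsTotal f]
    [HasPullback p f] : LocalHomeo I (pullback.snd p f) where
  part i := rest (pullback.fst p f ≫ L.part i) ≫ pullback.snd p f
  sec i := pullSection f (L.sec_isPartialSection i)
  total := inferInstance
  isPartialInverse i := by
    have hr : rest (pullSection f (L.sec_isPartialSection i)) = rest (f ≫ L.sec i) :=
      PCat.rest_lift _ _ _
    constructor
    · rw [rest_comp_total _ (pullback.snd p f), rest_rest, Category.assoc, comp_pullSection]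
      have e : rest (pullback.fst p f ≫ L.part i) ≫ pullback.snd p f ≫ f ≫ L.sec i =
          rest (pullback.fst p f ≫ L.part i) ≫ pullback.fst p f := by
        rw [← pullback.condition_assoc, ← Category.assoc, ← comp_rest, Category.assoc,
          ← Category.assoc (rest _), ← L.part_eq, L.part_sec]
      apply pullback.hom_ext
      · rw [comp_lift, pullback.lift_fst, e]
      · rw [comp_lift, pullback.lift_snd, ← Category.assoc, ← rest_rest_comp, e,
          rest_comp_total _ (pullback.fst p f), rest_rest]
    · rw [hr, ← Category.assoc, comp_rest, Category.assoc, pullSection, pullback.lift_snd,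
        pullback.lift_fst_assoc, Category.assoc, L.sec_part, rest_comp_rest, rest_idem]
  isJoin := by
    have h := (L.isJoin.comp_left_range (pullback.fst p f)).rest_range.comp_right_range
      (pullback.snd p f)
    rwa [(isTotal_comp _ p).rest_eq, Category.id_comp] at h

/-- The matrix of a pulled back local homeomorphism. -/
theorem pullback_matrix {Y : C} (L : LocalHomeo I p) (f : Y ⟶ X) [IsTotal p] [IsTotal f]
    [HasPullback p f] (i j : I) :
    (L.pullback f).sec i ≫ (L.pullback f).part j = rest (f ≫ L.sec i ≫ L.part j) := by
  change pullSection f (L.sec_isPartialSection i) ≫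
    rest (Limits.pullback.fst p f ≫ L.part j) ≫ Limits.pullback.snd p f = _
  rw [← Category.assoc, comp_rest, Category.assoc, pullSection, pullback.lift_snd,
    pullback.lift_fst_assoc, Category.assoc, rest_comm]
  have := rest_comp_le (f ≫ L.sec i) (L.part j)
  simpa only [Category.assoc] using this

/-- Local homeomorphisms admit pullbacks along total maps: the pullback along `f` is the glueing of
the pulled back matrix. -/
theorem isCarrable [HasLocalGlueings C] {I : Type v} (L : LocalHomeo I p) : IsCarrable p := by
  refine ⟨L.total, fun {Y} f hf => ?_⟩
  have hms : ∀ i j, rest (f ≫ L.sec i ≫ L.part j) ≫ f = f ≫ L.sec i ≫ L.part j := by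
    intro i j
    rw [← comp_rest, L.rest_matrix]
  have hatlas : IsLocalAtlas fun i j => rest (f ≫ L.sec i ≫ L.part j) := by
    refine ⟨fun i j => ⟨_, _, rfl⟩, fun i j => by rw [L.matrix_symm], fun i j k => ?_⟩
    have e : rest (f ≫ L.sec i ≫ L.part j) ≫ rest (f ≫ L.sec j ≫ L.part k) =
        rest (f ≫ L.sec i ≫ L.part j) ≫ rest (f ≫ L.sec i ≫ L.part k) := by
      have e1 := congrArg (fun x => f ≫ x) (L.matrix_comp_matrix i j k)
      simp only [Category.assoc] at e1
      rw [← rest_rest_comp, ← rest_rest_comp, reassoc_of% hms, reassoc_of% hms, e1]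
    rw [e]
    exact rest_comp_left_le _ _
  obtain ⟨g⟩ := HasLocalGlueings.exists_glueing _ hatlas
  let M := g.toLocalHomeo
  have hM : ∀ i j, M.sec i ≫ M.part j = rest (f ≫ L.sec i ≫ L.part j) := g.induces
  obtain ⟨h, hh⟩ := M.exists_desc (fun i => f ≫ L.sec i) (by
    intro i j
    have e := congrArg (fun x => f ≫ x) (L.matrix_comp_sec i j)
    simp only [Category.assoc] at e
    rw [hM, reassoc_of% hms, reassoc_of% hms, e])
  replace hh : ∀ i, M.sec i ≫ h = f ≫ L.sec i := by
    intro i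
    rw [hh, ← M.sec_part, hM, ← Category.assoc, hms, L.sec_part, Category.assoc, rest_comp]
  have hpart : ∀ i, h ≫ L.part i = M.part i ≫ f := by
    intro i
    refine M.hom_ext fun j => ?_
    rw [← Category.assoc, hh, ← Category.assoc, hM, hms, Category.assoc]
  have hcomm : h ≫ p = g.p ≫ f := by
    refine M.hom_ext fun i => ?_
    have : M.sec i ≫ g.p = _ := M.sec_isPartialSection i
    rw [← Category.assoc, hh, Category.assoc, L.sec_isPartialSection, ← Category.assoc, this,
      ← M.sec_part, hM, hms, L.sec_part]
  -- on the `i`-th chart of the glueing, a map into the glueing is recovered from its composites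
  -- with `h` and `g.p`
  have hext : ∀ {Z : C} (m m' : Z ⟶ g.A), m ≫ h = m' ≫ h → m ≫ g.p = m' ≫ g.p → m = m' := by
    intro Z m m' e1 e2
    have key : ∀ (m : Z ⟶ g.A) i, m ≫ rest (M.part i) =
        rest ((m ≫ h) ≫ L.part i) ≫ (m ≫ g.p) ≫ M.sec i := by
      intro m i
      rw [← M.part_sec, ← Category.assoc, M.part_eq, ← Category.assoc, comp_rest, Category.assoc,
        Category.assoc, Category.assoc, hpart, ← Category.assoc m (M.part i) f,
        rest_comp_total _ f, Category.assoc]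
    have := M.isJoin_rest_part
    have h1 := this.comp_left_range m
    have h2 := this.comp_left_range m'
    rw [show (fun i => m ≫ rest (M.part i)) = fun i => m' ≫ rest (M.part i) from
      funext fun i => by rw [key, key, e1, e2], Category.comp_id] at h1
    rw [Category.comp_id] at h2
    exact h1.unique h2
  have hlift : ∀ {Z : C} (a : Z ⟶ A) (b : Z ⟶ Y), a ≫ p = b ≫ f →
      ∃ z : Z ⟶ g.A, z ≫ h = a ∧ z ≫ g.p = b := by
    intro Z a b w
    have h1 : ∀ i, a ≫ L.part i = rest (a ≫ L.part i) ≫ b ≫ f := by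
      intro i
      rw [← w, ← Category.assoc, ← comp_rest, Category.assoc, ← L.part_eq]
    -- where both `a ≫ L.part i` and `a ≫ L.part j` are defined, the map `b` lands in the overlap
    -- `M.sec i ≫ M.part j` of the charts of the glueing
    have h2 : ∀ i j, rest (a ≫ L.part j) ≫ rest (a ≫ L.part i) ≫ b =
        (rest (a ≫ L.part j) ≫ rest (a ≫ L.part i) ≫ b) ≫ M.sec i ≫ M.part j := by
      intro i j
      have e : (rest (a ≫ L.part j) ≫ rest (a ≫ L.part i) ≫ b) ≫ f ≫ L.sec i ≫ L.part j =
          rest (a ≫ L.part i) ≫ a ≫ L.part j := by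
        have : rest (a ≫ L.part i) ≫ a = (a ≫ L.part i) ≫ L.sec i := by
          rw [← comp_rest, Category.assoc, L.part_sec]
        simp only [Category.assoc]
        rw [← Category.assoc b, ← Category.assoc _ (b ≫ f), ← h1, ← Category.assoc (a ≫ L.part i) (L.sec i),
          ← this]
        rw [Category.assoc, ← Category.assoc, rest_comm, Category.assoc, rest_comp]
      have e' : rest (rest (a ≫ L.part i) ≫ a ≫ L.part j) =
          rest (a ≫ L.part j) ≫ rest (a ≫ L.part i) := by
        rw [rest_rest_comp, rest_comm]
      rw [hM, comp_rest, e, e', ← Category.assoc (rest (a ≫ L.part j)), ← rest_rest_comp,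
        ← Category.assoc (rest (rest _ ≫ _)), rest_idem]
    have h3 : ∀ i, rest (rest (a ≫ L.part i) ≫ b ≫ M.sec i) = rest (a ≫ L.part i) := by
      intro i
      have e := h2 i i
      rw [← Category.assoc, rest_idem, M.sec_part] at e
      have eb : rest b = rest a := by
        rw [← rest_comp_total b f, ← w, rest_comp_total a p (hg := L.total)]
      rw [← Category.assoc, ← rest_comp_rest, ← e, rest_rest_comp, eb, rest_comm, rest_comp_le]
    -- the lift is glued from the restrictions of `b` followed by the sections of the glueing
    obtain ⟨z, hz⟩ := IsJoinRestriction.exists_join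
      (Set.range fun i => rest (a ≫ L.part i) ≫ b ≫ M.sec i) (by
        rintro _ ⟨i, rfl⟩ _ ⟨j, rfl⟩
        have e := congrArg (fun x => (rest (a ≫ L.part j) ≫ rest (a ≫ L.part i) ≫ b) ≫ x)
          (M.matrix_comp_sec i j)
        simp only [← Category.assoc _ _ (M.sec j), ← Category.assoc _ _ (M.sec i)] at e
        rw [← h2] at e
        simp only [Category.assoc] at e
        rw [Compat, h3, h3, ← e, ← Category.assoc, rest_comm, Category.assoc])
    refine ⟨z, ?_, ?_⟩
    · have e1 := hz.comp_right_range h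
      have e2 := L.isJoin_rest_part.comp_left_range a
      rw [Category.comp_id] at e2
      refine e1.unique ?_
      convert e2 using 3 with i
      simp only [Category.assoc]
      rw [hh, ← Category.assoc b, ← Category.assoc (rest _), ← h1, Category.assoc, L.part_sec]
    · have e1 := hz.comp_right_range g.p
      have e2 := (L.isJoin.comp_left_range a).rest_range.comp_right_range b
      rw [w, rest_comp_total b f, rest_comp] at e2
      refine e1.unique ?_
      convert e2 using 3 with i
      have e := h2 i i
      have e3 : M.sec i ≫ g.p = _ := M.sec_isPartialSection i
      rw [← Category.assoc, rest_idem, M.sec_part] at e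
      simp only [Category.assoc] at e ⊢
      rw [e3, ← e]
  exact ⟨⟨⟨PullbackCone.mk h g.p hcomm, PullbackCone.IsLimit.mk hcomm
    (fun s => (hlift s.fst s.snd s.condition).choose)
    (fun s => (hlift s.fst s.snd s.condition).choose_spec.1)
    (fun s => (hlift s.fst s.snd s.condition).choose_spec.2)
    (fun s m e1 e2 => hext _ _
      (e1.trans (hlift s.fst s.snd s.condition).choose_spec.1.symm)
      (e2.trans (hlift s.fst s.snd s.condition).choose_spec.2.symm))⟩⟩⟩

end LocalHomeo

/-! ### Valued equality -/

namespace RCatOver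

section

variable {C : Type u} [Category.{v} C] [RestrictionCategory C] (P : RCatOver.{w} C)

/-- Membership in `agreeSet f g`, with the condition `e ≤ rest f ≫ rest g` replaced by the equivalent
condition that `e` is the restriction of `e ≫ f`. -/
theorem map_mem_agreeSet {i j : P.carrier} {f g : i ⟶ j} {e : i ⟶ i} (he : rest e = e)
    (h : e ≫ f = e ≫ g) (hf : rest (e ≫ f) = e) : P.proj.map e ∈ P.agreeSet f g := by
  have key : ∀ k : i ⟶ j, rest (e ≫ k) = e → e ≫ rest k = e := by
    intro k hk
    rw [comp_rest, hk, ← he, rest_idem]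
  refine ⟨e, (isRestIdem_iff e).2 he, ?_, h, rfl⟩
  rw [Le, he, ← Category.assoc, key f hf, key g (h ▸ hf)]

theorem exists_of_mem_agreeSet {i j : P.carrier} {f g : i ⟶ j} {φ : P.proj.obj i ⟶ P.proj.obj i}
    (hφ : φ ∈ P.agreeSet f g) :
    ∃ e : i ⟶ i, rest e = e ∧ e ≫ f = e ≫ g ∧ rest (e ≫ f) = e ∧ φ = P.proj.map e := by
  obtain ⟨e, he, hle, h, rfl⟩ := hφ
  have he' := (isRestIdem_iff e).1 he
  refine ⟨e, he', h, ?_, rfl⟩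
  rw [Le, he'] at hle
  have e1 : e ≫ rest f = e := by
    conv_lhs => rw [hle]
    rw [Category.assoc, Category.assoc, rest_comm g f, ← Category.assoc (rest f), rest_idem]
    exact hle.symm
  rw [← rest_comp_rest, e1, he']

theorem agreeSet_symm {i j : P.carrier} (f g : i ⟶ j) : P.agreeSet f g = P.agreeSet g f := by
  have : ∀ f g : i ⟶ j, P.agreeSet f g ⊆ P.agreeSet g f := by
    intro f g φ hφ
    obtain ⟨e, he, h, hf, rfl⟩ := P.exists_of_mem_agreeSet hφ
    exact P.map_mem_agreeSet he h.symm (h ▸ hf)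
  exact (this f g).antisymm (this g f)

variable [IsJoinRestriction C]

theorem rest_valuedEq {i j : P.carrier} (f g : i ⟶ j) : rest (P.valuedEq f g) = P.valuedEq f g := by
  have h := (P.isJoin_valuedEq f g).rest
  rw [Set.image_congr (g := fun φ => φ) (fun φ hφ => P.rest_of_mem_agreeSet hφ),
    Set.image_id'] at h
  exact h.unique (P.isJoin_valuedEq f g)

theorem isLocalAtlas_valuedEq (i j : P.carrier) :
    IsLocalAtlas fun f g : i ⟶ j => P.valuedEq f g := by
  refine ⟨fun f g => (isRestIdem_iff _).2 (P.rest_valuedEq f g), fun f g => ?_, fun f g h => ?_⟩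
  · refine (P.isJoin_valuedEq f g).unique ?_
    rw [agreeSet_symm]
    exact P.isJoin_valuedEq g f
  · refine ((P.isJoin_valuedEq f g).comp_right _).2 _ ?_
    rintro _ ⟨φ, hφ, rfl⟩
    refine ((P.isJoin_valuedEq g h).comp_left φ).2 _ ?_
    rintro _ ⟨ψ, hψ, rfl⟩
    obtain ⟨e, he, h1, h2, rfl⟩ := P.exists_of_mem_agreeSet hφ
    obtain ⟨d, hd, h3, h4, rfl⟩ := P.exists_of_mem_agreeSet hψ
    have hc : e ≫ d = d ≫ e := by rw [← he, ← hd, rest_comm]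
    dsimp only
    rw [← P.proj.map_comp]
    refine (P.isJoin_valuedEq f h).1 _ (P.map_mem_agreeSet ?_ ?_ ?_)
    · rw [← he, rest_rest_comp, hd]
    · rw [hc, Category.assoc, h1, ← Category.assoc, ← hc, Category.assoc, h3, Category.assoc]
    · rw [hc, Category.assoc, ← rest_comp_rest, h2, ← hd, rest_rest_comp, he]

theorem valuedEq_self {i j : P.carrier} (f : i ⟶ j) : P.valuedEq f f = P.proj.map (rest f) := by
  refine le_antisymm' ((P.isJoin_valuedEq f f).2 _ ?_)
    ((P.isJoin_valuedEq f f).1 _ (P.map_mem_agreeSet (rest_rest f) rfl (by rw [rest_comp])))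
  intro φ hφ
  obtain ⟨e, he, h1, h2, rfl⟩ := P.exists_of_mem_agreeSet hφ
  have e1 : e = e ≫ rest f := by rw [comp_rest, h2, ← he, rest_idem]
  rw [Le, ← P.proj_rest, ← P.proj.map_comp, he, ← e1]

/-- Maps out of `P i` may be compared on the part where `f` and `g` agree by comparing them on each
restriction idempotent that equalises `f` and `g`. -/
theorem valuedEq_hom_ext {i j : P.carrier} {f g : i ⟶ j} {Y Z : C} (a : Y ⟶ P.proj.obj i)
    (x y : P.proj.obj i ⟶ Z)
    (h : ∀ e : i ⟶ i, rest e = e → e ≫ f = e ≫ g →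
      a ≫ P.proj.map e ≫ x = a ≫ P.proj.map e ≫ y) :
    a ≫ P.valuedEq f g ≫ x = a ≫ P.valuedEq f g ≫ y := by
  refine (P.isJoin_valuedEq f g).hom_ext a x y ?_
  intro φ hφ
  obtain ⟨e, he, h1, -, rfl⟩ := P.exists_of_mem_agreeSet hφ
  exact h e he h1

theorem valuedEq_comp_map {i j : P.carrier} (f g : i ⟶ j) :
    P.valuedEq f g ≫ P.proj.map f = P.valuedEq f g ≫ P.proj.map g := by
  have := P.valuedEq_hom_ext (f := f) (g := g) (𝟙 _) (P.proj.map f) (P.proj.map g)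
    (fun e _ h => by simp only [← P.proj.map_comp, h])
  simpa only [Category.id_comp] using this

/-- Valued equality is a congruence for composition. -/
theorem valuedEq_comp_le {i j k : P.carrier} (f f' : i ⟶ j) (h h' : j ⟶ k) :
    Le (rest (P.proj.map f ≫ P.valuedEq h h') ≫ P.valuedEq f f')
      (P.valuedEq (f ≫ h) (f' ≫ h')) := by
  refine ((P.isJoin_valuedEq f f').comp_left _).2 _ ?_
  rintro _ ⟨φ, hφ, rfl⟩
  -- for idempotents `d` and `e` equalising `f, f'` and `h, h'` respectively, the idempotent
  -- `rest (f ≫ e) ≫ d` equalises `f ≫ h` and `f' ≫ h'`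
  have hj := ((P.isJoin_valuedEq h h').comp_left (P.proj.map f)).rest.comp_right φ
  refine hj.2 _ ?_
  rintro _ ⟨_, ⟨_, ⟨ψ, hψ, rfl⟩, rfl⟩, rfl⟩
  obtain ⟨d, hd, h1, -, rfl⟩ := P.exists_of_mem_agreeSet hφ
  obtain ⟨e, he, h2, h3, rfl⟩ := P.exists_of_mem_agreeSet hψ
  dsimp only
  rw [← P.proj.map_comp, ← P.proj_rest, ← P.proj.map_comp]
  have hc : rest (f ≫ e) ≫ d = d ≫ rest (f ≫ e) := by rw [← hd, rest_comm]
  have hfe : rest (f ≫ e) ≫ f = f ≫ e := by rw [← comp_rest, he]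
  have key : (rest (f ≫ e) ≫ d) ≫ f ≫ h = d ≫ f ≫ e ≫ h := by
    rw [hc, Category.assoc, ← Category.assoc (rest _), hfe, Category.assoc]
  refine (P.isJoin_valuedEq _ _).1 _ (P.map_mem_agreeSet ?_ ?_ ?_)
  · rw [rest_rest_comp, hd]
  · have hdd : d ≫ d = d := by
      have := rest_idem d
      rwa [hd] at this
    have h4 : rest (f ≫ e) ≫ d = rest (d ≫ f' ≫ e) := by
      rw [hc]
      conv_lhs => rw [← hd, ← rest_rest_comp, hd, ← Category.assoc, h1, Category.assoc]
    have h5 : rest (f ≫ e) ≫ d = rest (d ≫ f' ≫ e) ≫ d := by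
      rw [← h4, Category.assoc, hdd]
    have h6 : rest (d ≫ f' ≫ e) ≫ d ≫ f' = d ≫ f' ≫ e := by
      have := comp_rest (d ≫ f') e
      rw [he] at this
      simpa only [Category.assoc] using this.symm
    rw [key, h5, Category.assoc, reassoc_of% h6, h2, reassoc_of% h1]
  · rw [key, ← Category.assoc, ← rest_comp_rest, h3, Category.assoc, ← rest_comp_rest, hc, ← hd,
      rest_rest_comp]
    simp only [rest_rest]

end

end RCatOver

instance Glueing.isCarrable {C : Type u} [Category.{v} C] [RestrictionCategory C]
    [IsJoinRestriction C] [HasLocalGlueings C] {X : C} {I : Type v} {φ : I → I → (X ⟶ X)}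
    (g : Glueing φ) : IsCarrable g.p :=
  g.toLocalHomeo.isCarrable

/-! ### The internalisation -/

namespace RCatOver.Glueings

variable {C : Type u} [Category.{v} C] [RestrictionCategory C] [IsJoinRestriction C]
  {P : RCatOver.{w} C} (g : P.Glueings)

/-- The source maps of the internalisation, as local homeomorphisms with one section for each
map of `P`. -/
noncomputable abbrev src (i j : P.carrier) : LocalHomeo (i ⟶ j) (g i j).p := (g i j).toLocalHomeo

theorem src_matrix {i j : P.carrier} (f f' : i ⟶ j) :
    (g.src i j).sec f ≫ (g.src i j).part f' = P.valuedEq f f' :=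
  (g i j).induces f f'

theorem rest_sec {i j : P.carrier} (f : i ⟶ j) :
    rest ((g.src i j).sec f) = rest (P.proj.map f) := by
  rw [← (g.src i j).sec_part, src_matrix, P.valuedEq_self, P.proj_rest]

theorem exists_tgtMap (i j : P.carrier) :
    ∃ t : (g i j).A ⟶ P.proj.obj j, ∀ f, (g.src i j).sec f ≫ t = P.proj.map f := by
  obtain ⟨t, ht⟩ := (g.src i j).exists_desc (fun f => P.proj.map f)
    (fun f f' => by rw [src_matrix, valuedEq_comp_map])
  exact ⟨t, fun f => by rw [ht, rest_sec, rest_comp]⟩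

/-- The target maps of the internalisation. -/
noncomputable def tgtMap (i j : P.carrier) : (g i j).A ⟶ P.proj.obj j :=
  (g.exists_tgtMap i j).choose

theorem sec_tgtMap {i j : P.carrier} (f : i ⟶ j) :
    (g.src i j).sec f ≫ g.tgtMap i j = P.proj.map f :=
  (g.exists_tgtMap i j).choose_spec f

instance isTotal_tgtMap (i j : P.carrier) : IsTotal (g.tgtMap i j) :=
  (g.src i j).total_of_sec fun f => by rw [sec_tgtMap, rest_sec]

variable [HasLocalGlueings C]

/-- The object of composable pairs is a local homeomorphism over `P i`, with one section for each
composable pair of maps of `P`. -/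
noncomputable def pairs (i j k : P.carrier) :
    LocalHomeo ((j ⟶ k) × (i ⟶ j)) (pullback.snd (g j k).p (g.tgtMap i j) ≫ (g i j).p) :=
  ((g.src j k).pullback (g.tgtMap i j)).comp (g.src i j)

theorem pairs_sec_eq {i j k : P.carrier} (f : i ⟶ j) (h : j ⟶ k) :
    (g.pairs i j k).sec (h, f) = (g.src i j).sec f ≫
      pullSection (g.tgtMap i j) ((g.src j k).sec_isPartialSection h) := rfl

theorem pairs_sec_fst {i j k : P.carrier} (f : i ⟶ j) (h : j ⟶ k) :
    (g.pairs i j k).sec (h, f) ≫ pullback.fst _ _ = P.proj.map f ≫ (g.src j k).sec h := by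
  rw [pairs_sec_eq, comp_pullSection, pullback.lift_fst, ← Category.assoc, sec_tgtMap]

theorem pairs_sec_snd {i j k : P.carrier} (f : i ⟶ j) (h : j ⟶ k) :
    (g.pairs i j k).sec (h, f) ≫ pullback.snd _ _ =
      rest (P.proj.map (f ≫ h)) ≫ (g.src i j).sec f := by
  rw [pairs_sec_eq, comp_pullSection, pullback.lift_snd, ← Category.assoc _ _ ((g.src j k).sec h),
    sec_tgtMap, ← rest_comp_rest, rest_sec, rest_comp_rest, P.proj.map_comp]

theorem exists_mulMap (i j k : P.carrier) :
    ∃ m : pullback (g j k).p (g.tgtMap i j) ⟶ (g i k).A,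
      ∀ (f : i ⟶ j) (h : j ⟶ k), (g.pairs i j k).sec (h, f) ≫ m = (g.src i k).sec (f ≫ h) := by
  have hmat : ∀ (f f' : i ⟶ j) (h h' : j ⟶ k),
      (g.pairs i j k).sec (h, f) ≫ (g.pairs i j k).part (h', f') =
        rest (P.proj.map f ≫ P.valuedEq h h') ≫ P.valuedEq f f' := by
    intro f f' h h'
    have e := (g.src j k).pullback_matrix (g.tgtMap i j) h h'
    rw [src_matrix] at e
    change ((g.src i j).sec f ≫ ((g.src j k).pullback (g.tgtMap i j)).sec h) ≫
      ((g.src j k).pullback (g.tgtMap i j)).part h' ≫ (g.src i j).part f' = _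
    rw [Category.assoc, ← Category.assoc _ _ ((g.src i j).part f'), e, ← Category.assoc, comp_rest,
      Category.assoc, src_matrix, ← Category.assoc, sec_tgtMap]
  obtain ⟨m, hm⟩ := (g.pairs i j k).exists_desc (fun x => (g.src i k).sec (x.2 ≫ x.1)) (by
    rintro ⟨h, f⟩ ⟨h', f'⟩
    have e := (g.src i k).matrix_comp_sec (f ≫ h) (f' ≫ h')
    rw [src_matrix] at e
    rw [hmat, P.valuedEq_comp_le f f' h h', Category.assoc, Category.assoc, e])
  refine ⟨m, fun f h => ?_⟩
  have hr : rest ((g.pairs i j k).sec (h, f)) = rest ((g.src i k).sec (f ≫ h)) := by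
    rw [← rest_comp_total _ (pullback.snd (g j k).p (g.tgtMap i j)), pairs_sec_snd, rest_rest_comp,
      rest_sec, rest_sec, P.proj.map_comp, rest_comm, rest_comp_le]
  rw [hm, hr, rest_comp]

/-- The composition maps of the internalisation. -/
noncomputable def mulMap (i j k : P.carrier) :
    pullback (g j k).p (g.tgtMap i j) ⟶ (g i k).A :=
  (g.exists_mulMap i j k).choose

theorem pairs_sec_mulMap {i j k : P.carrier} (f : i ⟶ j) (h : j ⟶ k) :
    (g.pairs i j k).sec (h, f) ≫ g.mulMap i j k = (g.src i k).sec (f ≫ h) :=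
  (g.exists_mulMap i j k).choose_spec f h

/-- The composition maps on generalised elements that come from maps of `P`. -/
theorem lift_mulMap {Z : C} {i j k : P.carrier} (f : i ⟶ j) (h : j ⟶ k) (z : Z ⟶ P.proj.obj i)
    {b : Z ⟶ (g j k).A} {a : Z ⟶ (g i j).A} (w : b ≫ (g j k).p = a ≫ g.tgtMap i j)
    (hb : b = z ≫ P.proj.map f ≫ (g.src j k).sec h)
    (ha : a = z ≫ rest (P.proj.map (f ≫ h)) ≫ (g.src i j).sec f) :
    pullback.lift b a w ≫ g.mulMap i j k = z ≫ (g.src i k).sec (f ≫ h) := by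
  have e : pullback.lift b a w = z ≫ (g.pairs i j k).sec (h, f) := by
    apply pullback.hom_ext
    · rw [pullback.lift_fst, Category.assoc, pairs_sec_fst, hb]
    · rw [pullback.lift_snd, Category.assoc, pairs_sec_snd, ha]
  rw [e, Category.assoc, pairs_sec_mulMap]

/-- The object of composable triples is a local homeomorphism over `P i`, with one section for each
composable triple of maps of `P`. -/
noncomputable def triples (i j k l : P.carrier) :
    LocalHomeo ((k ⟶ l) × (j ⟶ k) × (i ⟶ j))
      (pullback.snd (g k l).p (pullback.fst (g j k).p (g.tgtMap i j) ≫ g.tgtMap j k) ≫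
        pullback.snd (g j k).p (g.tgtMap i j) ≫ (g i j).p) :=
  ((g.src k l).pullback (pullback.fst (g j k).p (g.tgtMap i j) ≫ g.tgtMap j k)).comp
    (g.pairs i j k)

theorem triples_sec_eq {i j k l : P.carrier} (f : i ⟶ j) (h : j ⟶ k) (m : k ⟶ l) :
    (g.triples i j k l).sec (m, h, f) = (g.pairs i j k).sec (h, f) ≫
      pullSection (pullback.fst (g j k).p (g.tgtMap i j) ≫ g.tgtMap j k)
        ((g.src k l).sec_isPartialSection m) := rfl

theorem triples_sec_fst {i j k l : P.carrier} (f : i ⟶ j) (h : j ⟶ k) (m : k ⟶ l) :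
    (g.triples i j k l).sec (m, h, f) ≫ pullback.fst _ _ =
      P.proj.map (f ≫ h) ≫ (g.src k l).sec m := by
  rw [triples_sec_eq, comp_pullSection, pullback.lift_fst, Category.assoc,
    reassoc_of% (g.pairs_sec_fst f h), reassoc_of% (g.sec_tgtMap h), P.proj.map_comp,
    Category.assoc]

theorem triples_sec_snd {i j k l : P.carrier} (f : i ⟶ j) (h : j ⟶ k) (m : k ⟶ l) :
    (g.triples i j k l).sec (m, h, f) ≫ pullback.snd _ _ =
      rest (P.proj.map (f ≫ h ≫ m)) ≫ (g.pairs i j k).sec (h, f) := by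
  rw [triples_sec_eq, comp_pullSection, pullback.lift_snd, Category.assoc,
    reassoc_of% (g.pairs_sec_fst f h), reassoc_of% (g.sec_tgtMap h), ← Category.assoc,
    ← rest_comp_rest, rest_sec, rest_comp_rest, Category.assoc, P.proj.map_comp, P.proj.map_comp]

/-- The partite internal category structure on a choice of glueings. All its laws are checked on
the sections coming from maps of `P`, where they reduce to the laws of the category `P`. -/
noncomputable def str : PartiteStr fun i j => (g i j).p where
  τ := g.tgtMap
  η i := (g.src i i).sec (𝟙 i)
  η_src i := by
    rw [(g.src i i).sec_isPartialSection, rest_sec, P.proj.map_id, rest_id]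
  η_tgt i := by rw [sec_tgtMap, P.proj.map_id]
  μ := g.mulMap
  μ_src i j k := by
    refine (g.pairs i j k).hom_ext ?_
    rintro ⟨h, f⟩
    rw [← Category.assoc, pairs_sec_mulMap, (g.src i k).sec_isPartialSection, rest_sec,
      reassoc_of% (g.pairs_sec_snd f h), (g.src i j).sec_isPartialSection, rest_sec,
      P.proj.map_comp, rest_comm, rest_comp_le]
  μ_tgt i j k := by
    refine (g.pairs i j k).hom_ext ?_
    rintro ⟨h, f⟩
    rw [← Category.assoc, pairs_sec_mulMap, sec_tgtMap, reassoc_of% (g.pairs_sec_fst f h),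
      sec_tgtMap, P.proj.map_comp]
  right_unit i j := by
    refine (g.src i j).hom_ext fun f => ?_
    rw [comp_lift_comp]
    refine (g.lift_mulMap (𝟙 i) f (𝟙 _) _ ?_ ?_).trans ?_
    · simp
    · rw [← Category.assoc, (g.src i j).sec_isPartialSection, rest_sec, Category.id_comp,
        Category.id_comp]
    · simp
  left_unit i j := by
    refine (g.src i j).hom_ext fun f => ?_
    rw [comp_lift_comp]
    refine (g.lift_mulMap f (𝟙 j) (𝟙 _) _ ?_ ?_).trans ?_
    · rw [← Category.assoc, sec_tgtMap, Category.id_comp]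
    · rw [Category.comp_id, Category.comp_id, Category.id_comp, ← rest_sec, rest_comp]
    · simp
  assoc i j k l := by
    refine (g.triples i j k l).hom_ext ?_
    rintro ⟨m, h, f⟩
    rw [comp_lift_comp, comp_lift_comp]
    refine (g.lift_mulMap (f ≫ h) m (𝟙 _) _ ?_ ?_).trans
      (Eq.trans ?_ (g.lift_mulMap f (h ≫ m) (𝟙 _) _ ?_ ?_).symm)
    · rw [triples_sec_fst, Category.id_comp]
    · rw [reassoc_of% (g.triples_sec_snd f h m), pairs_sec_mulMap, Category.id_comp,
        Category.assoc]
    · rw [Category.assoc]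
    · rw [comp_lift_comp, Category.id_comp]
      refine g.lift_mulMap h m (P.proj.map f) _ ?_ ?_
      · rw [triples_sec_fst, P.proj.map_comp, Category.assoc]
      · rw [reassoc_of% (g.triples_sec_snd f h m), pairs_sec_fst, ← Category.assoc (P.proj.map f),
          comp_rest, ← P.proj.map_comp, Category.assoc]
    · rw [reassoc_of% (g.triples_sec_snd f h m), pairs_sec_snd, Category.id_comp,
        ← Category.assoc f h m, P.proj.map_comp (f ≫ h) m, ← Category.assoc,
        rest_comm _ (P.proj.map (f ≫ h)), rest_comp_le]

theorem isInternalisation_str : g.IsInternalisation g.str where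
  tgt f := g.sec_tgtMap f
  ident _ := rfl
  comp {i j k} f h := by
    exact (Category.assoc _ _ _).symm.trans (g.pairs_sec_mulMap f h)

/-- Uniqueness of the internalisation: the defining equations fix the structure maps on jointly
epimorphic families of sections. -/
theorem IsInternalisation.eq_str {S : PartiteStr fun i j => (g i j).p}
    (hS : g.IsInternalisation S) : S = g.str := by
  obtain ⟨τ, η, η_src, η_tgt, μ, μ_src, μ_tgt, r, l, a⟩ := S
  obtain ⟨h1, h2, h3⟩ := hS
  dsimp only at h1 h2
  obtain rfl : τ = g.tgtMap := by
    funext i j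
    exact (g.src i j).hom_ext fun f => (h1 f).trans (g.sec_tgtMap f).symm
  obtain rfl : η = fun i => (g.src i i).sec (𝟙 i) := funext h2
  obtain rfl : μ = g.mulMap := by
    funext i j k
    refine (g.pairs i j k).hom_ext ?_
    rintro ⟨h, f⟩
    rw [pairs_sec_mulMap, pairs_sec_eq, Category.assoc]
    exact h3 f h
  rfl

end RCatOver.Glueings

/-! ### The universal property -/

namespace RCatOver.Hom

variable {C : Type u} [Category.{v} C] [RestrictionCategory C] {P : RCatOver.{w} C}
  {B : PCat.{w} C} (G : RCatOver.Hom P B.externalisation)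

/-- The component of `B` to which `G` sends the object `i`. -/
def idx (i : P.carrier) : B.I := G.functor.obj i

/-- The component at `i` of the natural transformation of `G`. -/
def objMap (i : P.carrier) : B.obj (G.idx i) ⟶ P.proj.obj i := G.nat.app i

instance isTotal_objMap (i : P.carrier) : IsTotal (G.objMap i) := G.nat_total i

/-- The partial section of a source map of `B` to which `G` sends `f`. -/
def secMap {i j : P.carrier} (f : i ⟶ j) : B.PSec (G.idx i) (G.idx j) := G.functor.map f

theorem app_heq {Q : RCatOver.{w} C} {F F' : RCatOver.Hom P Q} (h : F = F') (i : P.carrier) :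
    HEq (F.nat.app i) (F'.nat.app i) := by
  rw [h]

theorem map_heq {Q : RCatOver.{w} C} {F F' : RCatOver.Hom P Q} (h : F = F') {i j : P.carrier}
    (f : i ⟶ j) : HEq (F.functor.map f) (F'.functor.map f) := by
  rw [h]

theorem secMap_tgt {i j : P.carrier} (f : i ⟶ j) :
    (G.secMap f).1 ≫ B.tgt _ _ ≫ G.objMap j = G.objMap i ≫ P.proj.map f :=
  (Category.assoc (G.secMap f).1 (B.tgt (G.idx i) (G.idx j)) (G.objMap j)).symm.trans
    (G.nat.naturality f)

theorem rest_secMap {i j : P.carrier} (f : i ⟶ j) :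
    rest (G.secMap f).1 = rest (G.objMap i ≫ P.proj.map f) := by
  rw [← secMap_tgt, rest_comp_total]

theorem rest_secMap_comp_rest {i j k : P.carrier} (f : i ⟶ j) (h : j ⟶ k) :
    rest (G.secMap (f ≫ h)).1 ≫ rest (G.secMap f).1 = rest (G.secMap (f ≫ h)).1 := by
  have := rest_comp_le (G.objMap i ≫ P.proj.map f) (P.proj.map h)
  rw [G.rest_secMap, G.rest_secMap, rest_comm, P.proj.map_comp, ← Category.assoc, this]

theorem secMap_id (i : P.carrier) : (G.secMap (𝟙 i)).1 = B.ident (G.idx i) :=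
  congrArg Subtype.val (G.functor.map_id i)

theorem secMap_comp {i j k : P.carrier} (f : i ⟶ j) (h : j ⟶ k) :
    (G.secMap (f ≫ h)).1 = PCat.starMap (G.secMap f) (G.secMap h) :=
  congrArg Subtype.val (G.functor.map_comp f h)

theorem secMap_restIdem_comp {i j : P.carrier} {e : i ⟶ i} (he : rest e = e) (f : i ⟶ j) :
    (G.secMap (e ≫ f)).1 = rest (G.objMap i ≫ P.proj.map e) ≫ (G.secMap f).1 := by
  have h : G.secMap e = PCat.restSec (G.secMap e) := by
    have := G.map_rest e
    rw [he] at this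
    exact this
  rw [secMap_comp, ← rest_secMap]
  exact (congrArg (fun s => PCat.starMap s (G.secMap f)) h).trans (PCat.restSec_star _ _)

/-- The partial sections assigned to `f` and `f'` agree where `f` and `f'` do. -/
theorem valuedEq_comp_secMap [IsJoinRestriction C] {i j : P.carrier} (f f' : i ⟶ j) :
    rest (G.objMap i ≫ P.valuedEq f f') ≫ (G.secMap f).1 =
      rest (G.objMap i ≫ P.valuedEq f f') ≫ (G.secMap f').1 := by
  have hj := ((P.isJoin_valuedEq f f').comp_left (G.objMap i)).rest
  have := hj.hom_ext (𝟙 _) (G.secMap f).1 (G.secMap f').1 (by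
    rintro _ ⟨_, ⟨φ, hφ, rfl⟩, rfl⟩
    obtain ⟨e, he, h, -, rfl⟩ := P.exists_of_mem_agreeSet hφ
    dsimp only
    rw [← secMap_restIdem_comp G he, ← secMap_restIdem_comp G he, h])
  simpa only [Category.id_comp] using this

end RCatOver.Hom

namespace RCatOver.Glueings

variable {C : Type u} [Category.{v} C] [RestrictionCategory C] [IsJoinRestriction C]
  [HasLocalGlueings C] {P : RCatOver.{w} C} (g : P.Glueings) {B : PCat.{w} C}

section

variable (G : RCatOver.Hom P B.externalisation)

/-- The domain of the arrow part of a cofunctor is a local homeomorphism over `B`, with one section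
for each map of `P`. -/
noncomputable def pulledSrc (i j : P.carrier) :
    LocalHomeo (i ⟶ j) (pullback.snd (g i j).p (G.objMap i)) :=
  (g.src i j).pullback (G.objMap i)

theorem pulledSrc_sec_fst {i j : P.carrier} (f : i ⟶ j) :
    (g.pulledSrc G i j).sec f ≫ pullback.fst _ _ = G.objMap i ≫ (g.src i j).sec f :=
  pullback.lift_fst _ _ _

theorem pulledSrc_sec_snd {i j : P.carrier} (f : i ⟶ j) :
    (g.pulledSrc G i j).sec f ≫ pullback.snd _ _ = rest (G.secMap f).1 := by
  refine (pullback.lift_snd _ _ _).trans ?_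
  rw [G.rest_secMap, ← rest_comp_rest, rest_sec, rest_comp_rest]

theorem exists_arrMap (i j : P.carrier) :
    ∃ m : pullback (g i j).p (G.objMap i) ⟶ B.arr (G.idx i) (G.idx j),
      ∀ f, (g.pulledSrc G i j).sec f ≫ m = (G.secMap f).1 := by
  have hmat : ∀ f f' : i ⟶ j, (g.pulledSrc G i j).sec f ≫ (g.pulledSrc G i j).part f' =
      rest (G.objMap i ≫ P.valuedEq f f') := by
    intro f f'
    have e := (g.src i j).pullback_matrix (G.objMap i) f f'
    rwa [src_matrix] at e
  obtain ⟨m, hm⟩ := (g.pulledSrc G i j).exists_desc (fun f => (G.secMap f).1)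
    (fun f f' => by rw [hmat, G.valuedEq_comp_secMap])
  refine ⟨m, fun f => ?_⟩
  rw [hm, ← rest_comp_total _ (pullback.snd (g i j).p (G.objMap i)), pulledSrc_sec_snd, rest_rest,
    rest_comp]

/-- The arrow part of the cofunctor induced by `G`. -/
noncomputable def arrMap (i j : P.carrier) :
    pullback (g i j).p (G.objMap i) ⟶ B.arr (G.idx i) (G.idx j) :=
  (g.exists_arrMap G i j).choose

theorem pulledSrc_sec_arrMap {i j : P.carrier} (f : i ⟶ j) :
    (g.pulledSrc G i j).sec f ≫ g.arrMap G i j = (G.secMap f).1 :=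
  (g.exists_arrMap G i j).choose_spec f

/-- The arrow part of the induced cofunctor on generalised elements that come from maps of `P`. -/
theorem lift_arrMap {Z : C} {i j : P.carrier} (f : i ⟶ j) (z : Z ⟶ B.obj (G.idx i))
    {a : Z ⟶ (g i j).A} {b : Z ⟶ B.obj (G.idx i)} (w : a ≫ (g i j).p = b ≫ G.objMap i)
    (ha : a = z ≫ G.objMap i ≫ (g.src i j).sec f) (hb : b = z ≫ rest (G.secMap f).1) :
    pullback.lift a b w ≫ g.arrMap G i j = z ≫ (G.secMap f).1 := by
  have e : pullback.lift a b w = z ≫ (g.pulledSrc G i j).sec f := by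
    apply pullback.hom_ext
    · rw [pullback.lift_fst, Category.assoc, pulledSrc_sec_fst, ha]
    · rw [pullback.lift_snd, Category.assoc, pulledSrc_sec_snd, hb]
  rw [e, Category.assoc, pulledSrc_sec_arrMap]

/-- The domain of the composition axiom of a cofunctor is a local homeomorphism over `B`, with one
section for each composable pair of maps of `P`. -/
noncomputable def pulledPairs (i j k : P.carrier) :
    LocalHomeo ((j ⟶ k) × (i ⟶ j))
      (pullback.snd (g j k).p (pullback.fst (g i j).p (G.objMap i) ≫ g.tgtMap i j) ≫
        pullback.snd (g i j).p (G.objMap i)) :=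
  ((g.src j k).pullback (pullback.fst (g i j).p (G.objMap i) ≫ g.tgtMap i j)).comp
    (g.pulledSrc G i j)

theorem pulledPairs_sec_eq {i j k : P.carrier} (f : i ⟶ j) (h : j ⟶ k) :
    (g.pulledPairs G i j k).sec (h, f) = (g.pulledSrc G i j).sec f ≫
      pullSection (pullback.fst (g i j).p (G.objMap i) ≫ g.tgtMap i j)
        ((g.src j k).sec_isPartialSection h) := rfl

theorem pulledPairs_sec_fst {i j k : P.carrier} (f : i ⟶ j) (h : j ⟶ k) :
    (g.pulledPairs G i j k).sec (h, f) ≫ pullback.fst _ _ =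
      G.objMap i ≫ P.proj.map f ≫ (g.src j k).sec h := by
  rw [pulledPairs_sec_eq, comp_pullSection, pullback.lift_fst, Category.assoc,
    reassoc_of% (g.pulledSrc_sec_fst G f), reassoc_of% (g.sec_tgtMap f)]

theorem pulledPairs_sec_snd {i j k : P.carrier} (f : i ⟶ j) (h : j ⟶ k) :
    (g.pulledPairs G i j k).sec (h, f) ≫ pullback.snd _ _ =
      rest (G.secMap (f ≫ h)).1 ≫ (g.pulledSrc G i j).sec f := by
  rw [pulledPairs_sec_eq, comp_pullSection, pullback.lift_snd, Category.assoc,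
    reassoc_of% (g.pulledSrc_sec_fst G f), reassoc_of% (g.sec_tgtMap f),
    ← Category.assoc (G.objMap i), ← rest_comp_rest, rest_sec,
    rest_comp_rest, G.rest_secMap, P.proj.map_comp, Category.assoc]

theorem arrMap_src (i j : P.carrier) :
    g.arrMap G i j ≫ B.src (G.idx i) (G.idx j) = pullback.snd (g i j).p (G.objMap i) := by
  refine (g.pulledSrc G i j).hom_ext fun f => ?_
  rw [← Category.assoc, pulledSrc_sec_arrMap]
  exact (G.secMap f).2.trans (g.pulledSrc_sec_snd G f).symm

theorem isTotal_arrMap (i j : P.carrier) : IsTotal (g.arrMap G i j) :=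
  isTotal_of_comp _ (B.src (G.idx i) (G.idx j)) (by rw [arrMap_src]; infer_instance)

theorem arrMap_tgt (i j : P.carrier) :
    g.arrMap G i j ≫ B.tgt (G.idx i) (G.idx j) ≫ G.objMap j =
      pullback.fst (g i j).p (G.objMap i) ≫ g.tgtMap i j := by
  refine (g.pulledSrc G i j).hom_ext fun f => ?_
  rw [← Category.assoc, pulledSrc_sec_arrMap, G.secMap_tgt, ← g.sec_tgtMap f,
    ← Category.assoc (G.objMap i), ← g.pulledSrc_sec_fst G f, Category.assoc]

theorem lift_ident_arrMap (i : P.carrier)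
    (w : (G.objMap i ≫ (g.src i i).sec (𝟙 i)) ≫ (g i i).p = 𝟙 _ ≫ G.objMap i) :
    pullback.lift (G.objMap i ≫ (g.src i i).sec (𝟙 i)) (𝟙 (B.obj (G.idx i))) w ≫
      g.arrMap G i i = B.ident (G.idx i) := by
  refine (g.lift_arrMap G (𝟙 i) (𝟙 _) _ ?_ ?_).trans ?_
  · rw [Category.id_comp]
  · rw [Category.id_comp, G.rest_secMap, P.proj.map_id, Category.comp_id,
      (G.isTotal_objMap i).rest_eq]
  · rw [Category.id_comp, G.secMap_id]

/-- The composition axiom for the induced cofunctor. On the section given by `f` and `h`, both sides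
are the composite of the partial sections that `G` assigns to `f` and `h`. The projections `a'` and
`r` of the triple fibre product are variables so that they can be rewritten inside the lifts. -/
theorem arrMap_mul (i j k : P.carrier) {a' : _ ⟶ (g j k).A}
    {r : _ ⟶ pullback (g i j).p (G.objMap i)}
    (ha' : a' = pullback.fst (g j k).p (pullback.fst (g i j).p (G.objMap i) ≫ g.tgtMap i j))
    (hr : r = pullback.snd (g j k).p (pullback.fst (g i j).p (G.objMap i) ≫ g.tgtMap i j))
    (w₁ : a' ≫ (g j k).p = (r ≫ pullback.fst _ _) ≫ g.tgtMap i j)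
    (w₂ : (pullback.lift a' (r ≫ pullback.fst _ _) w₁ ≫ g.mulMap i j k) ≫ (g i k).p =
      (r ≫ pullback.snd _ _) ≫ G.objMap i)
    (w₃ : a' ≫ (g j k).p = (r ≫ g.arrMap G i j ≫ B.tgt _ _) ≫ G.objMap j)
    (w₄ : (pullback.lift a' (r ≫ g.arrMap G i j ≫ B.tgt _ _) w₃ ≫ g.arrMap G j k) ≫ B.src _ _ =
      (r ≫ g.arrMap G i j) ≫ B.tgt _ _) :
    pullback.lift (pullback.lift a' (r ≫ pullback.fst _ _) w₁ ≫ g.mulMap i j k)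
        (r ≫ pullback.snd _ _) w₂ ≫ g.arrMap G i k =
      pullback.lift (pullback.lift a' (r ≫ g.arrMap G i j ≫ B.tgt _ _) w₃ ≫ g.arrMap G j k)
        (r ≫ g.arrMap G i j) w₄ ≫ B.mu _ _ _ := by
  refine (g.pulledPairs G i j k).hom_ext ?_
  rintro ⟨h, f⟩
  have h1 := (congrArg (fun x => (g.pulledPairs G i j k).sec (h, f) ≫ x) ha').trans
    (g.pulledPairs_sec_fst G f h)
  have h2 := (congrArg (fun x => (g.pulledPairs G i j k).sec (h, f) ≫ x) hr).trans
    (g.pulledPairs_sec_snd G f h)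
  have h3 : rest (G.secMap (f ≫ h)).1 =
      rest ((G.secMap f).1 ≫ B.tgt (G.idx i) (G.idx j) ≫ (G.secMap h).1) := by
    rw [G.secMap_comp, PCat.rest_starMap]
  refine (comp_lift_comp _ _ _ _ _).trans (Eq.trans ?_ (comp_lift_comp _ _ _ _ _).symm)
  refine (g.lift_arrMap G (f ≫ h) (𝟙 _) _ ?_ ?_).trans ?_
  · rw [comp_lift_comp, Category.id_comp]
    refine g.lift_mulMap f h (G.objMap i) _ h1 ?_
    rw [reassoc_of% h2, pulledSrc_sec_fst, ← Category.assoc (G.objMap i), comp_rest,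
      G.rest_secMap, Category.assoc]
  · rw [reassoc_of% h2, pulledSrc_sec_snd, G.rest_secMap_comp_rest, Category.id_comp]
  · rw [Category.id_comp, G.secMap_comp, PCat.starMap_eq, PCat.comp]
    refine lift_congr rfl HEq.rfl _ _ ?_ ?_
    · rw [comp_lift_comp, ← Category.assoc (G.secMap f).1]
      refine (g.lift_arrMap G h _ _ ?_ ?_).symm
      · rw [h1, Category.assoc, reassoc_of% (G.secMap_tgt f)]
      · rw [reassoc_of% h2, reassoc_of% (g.pulledSrc_sec_arrMap G f), comp_rest, h3]
        simp only [Category.assoc]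
    · rw [reassoc_of% h2, pulledSrc_sec_arrMap, h3]

/-- The cofunctor induced by `G`. Its axioms are checked on the sections coming from maps of `P`,
where they express that `G` is natural and functorial. -/
noncomputable def cofunctor : PCat.Cofunctor (g.toPCat g.str) B where
  idx := G.idx
  onObj := G.objMap
  onObj_total := G.isTotal_objMap
  onArr := g.arrMap G
  onArr_total := g.isTotal_arrMap G
  src := g.arrMap_src G
  tgt := g.arrMap_tgt G
  ident i := g.lift_ident_arrMap G i _
  mul i j k := g.arrMap_mul G i j k rfl rfl _ _ _ _

/-- The internalisation on the glueings `g`. -/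
noncomputable abbrev internalisation : P.Internalisation :=
  ⟨g, g.str, g.isInternalisation_str⟩

theorem unit_comp_cofunctor :
    RCatOver.Hom.comp g.internalisation.unitHom (g.cofunctor G).externalisation = G := by
  refine RCatOver.Hom.ext_of _ _ (Functor.hext (fun i => rfl) ?_) ?_
  · intro i j f
    refine heq_of_eq (Subtype.ext ?_)
    exact g.pulledSrc_sec_arrMap G f
  · intro i
    exact heq_of_eq (Category.comp_id (G.objMap i))

end

/-- A cofunctor out of the internalisation is determined by its composite with the unit. -/
theorem cofunctor_ext {F F' : PCat.Cofunctor (g.toPCat g.str) B}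
    (h : RCatOver.Hom.comp g.internalisation.unitHom F.externalisation =
      RCatOver.Hom.comp g.internalisation.unitHom F'.externalisation) : F = F' := by
  obtain ⟨x, x0, x1, h1, h2, h3, h4⟩ := F
  obtain ⟨y, y0, y1, h1', h2', h3', h4'⟩ := F'
  obtain rfl : x = y := congrArg (fun K => K.functor.obj) h
  obtain rfl : x0 = y0 := by
    funext i
    have e := eq_of_heq (RCatOver.Hom.app_heq h i)
    exact ((Category.comp_id (x0 i)).symm.trans e).trans (Category.comp_id (y0 i))
  obtain rfl : x1 = y1 := by
    funext i j
    exact (LocalHomeo.pullback (p := (g.toPCat g.str).src i j) (g.src i j) (x0 i)).hom_ext fun f =>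
      congrArg Subtype.val (eq_of_heq (RCatOver.Hom.map_heq h f))
  rfl

end RCatOver.Glueings

section

variable {C : Type u} [Category.{v} C] [RestrictionCategory C] [IsJoinRestriction C]
  [HasLocalGlueings C]

theorem RCatOver.Internalisation.existsUnique_cofunctor {P : RCatOver.{w} C}
    (N : P.Internalisation) {B : PCat.{w} C} (G : P ⟶ (PCat.Phi C).obj B) :
    ∃! F : N.toPCat ⟶ B, N.unit ≫ (PCat.Phi C).map F = G := by
  obtain ⟨g, S, hS⟩ := N
  obtain rfl := hS.eq_str
  exact ⟨g.cofunctor G, g.unit_comp_cofunctor G,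
    fun F hF => g.cofunctor_ext (hF.trans (g.unit_comp_cofunctor G).symm)⟩

/-- The bijection between cofunctors out of the internalisation and maps into an
externalisation. -/
noncomputable def RCatOver.Internalisation.homEquiv {P : RCatOver.{w} C}
    (N : P.Internalisation) (B : PCat.{w} C) :
    (N.toPCat ⟶ B) ≃ (P ⟶ (PCat.Phi C).obj B) :=
  Equiv.ofBijective (fun F => N.unit ≫ (PCat.Phi C).map F)
    (Function.bijective_iff_existsUnique _ |>.2 N.existsUnique_cofunctor)

theorem RCatOver.Internalisation.homEquiv_comp {P : RCatOver.{w} C}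
    (N : P.Internalisation) {B B' : PCat.{w} C} (F : N.toPCat ⟶ B) (k : B ⟶ B') :
    N.homEquiv B' (F ≫ k) = N.homEquiv B F ≫ (PCat.Phi C).map k := by
  change N.unit ≫ (PCat.Phi C).map (F ≫ k) =
    (N.unit ≫ (PCat.Phi C).map F) ≫ (PCat.Phi C).map k
  rw [Functor.map_comp, Category.assoc]

end

/-- The adjunction between partite internal categories with cofunctors and restriction
categories over `C` with lax triangles, for a join restriction category `C` with local
glueings. -/
theorem mainTheorem2 (C : Type u) [Category.{v} C] [RestrictionCategory C]
    [IsJoinRestriction C] [HasLocalGlueings C] :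
    -- internalisations are well defined, for every choice of glueings
    (∀ P : RCatOver.{w, v, u} C, Nonempty P.Glueings ∧
      ∀ g : P.Glueings, ∃! S : PartiteStr fun i j => (g i j).p, g.IsInternalisation S) ∧
    -- the unit map exhibits the internalisation as the value of a left adjoint
    (∀ (P : RCatOver.{w, v, u} C) (N : P.Internalisation) (B : PCat.{w, v, u} C)
      (G : P ⟶ (PCat.Phi.{w, v, u} C).obj B),
      ∃! F : N.toPCat ⟶ B, N.unit ≫ (PCat.Phi.{w, v, u} C).map F = G) ∧
    -- the resulting adjunction
    (∀ N : ∀ P : RCatOver.{w, v, u} C, P.Internalisation,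
      ∃ (Psi : RCatOver.{w, v, u} C ⥤ PCat.{w, v, u} C) (adj : Psi ⊣ PCat.Phi.{w, v, u} C)
        (hobj : ∀ P, Psi.obj P = (N P).toPCat),
        ∀ P, adj.unit.app P ≫ (PCat.Phi.{w, v, u} C).map (eqToHom (hobj P)) = (N P).unit) := by
  refine ⟨fun P => ⟨?_, fun g => ⟨g.str, g.isInternalisation_str, fun S hS => hS.eq_str⟩⟩,
    fun P N B G => N.existsUnique_cofunctor G, fun N => ?_⟩
  · exact ⟨fun i j => (HasLocalGlueings.exists_glueing _ (P.isLocalAtlas_valuedEq i j)).some⟩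
  · refine ⟨_, Adjunction.adjunctionOfEquivLeft (G := PCat.Phi.{w, v, u} C)
      (fun P B => (N P).homEquiv B) (fun P B B' k F => (N P).homEquiv_comp F k),
      fun P => rfl, fun P => ?_⟩
    change ((N P).unit ≫ (PCat.Phi C).map (𝟙 (N P).toPCat)) ≫
      (PCat.Phi C).map (𝟙 (N P).toPCat) = _
    rw [CategoryTheory.Functor.map_id, Category.comp_id, Category.comp_id]
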